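/- Conventions. Let $\mathbb H$ be the real quaternions. For a matrix $A$ over $\mathbb H$ let $A^*$ be its conjugate transpose, $\operatorname{rank}A$ the dimension of the right $\mathbb H$-vector space spanned by its columns, $\|A\|$ its Frobenius norm, and $A^+$ its Moore–Penrose inverse, i.e. the matrix with $(AA^+)^*=AA^+$, $(A^+A)^*=A^+A$, $AA^+A=A$, $A^+AA^+=A^+$. For a square matrix $M=(m_{ab})$ whose rows and columns are indexed by a finite totally ordered set $I$ with $n$ elements, and $i\in I$, the *row determinant* is $$\operatorname{rdet}_i M=\sum_{\sigma}(-1)^{n-r}\,P_1P_2\cdots P_r,$$ the sum being over all permutations $\sigma$ of $I$, with cycles (fixed points included) $C_1,\dots,C_r$, where $C_1$ contains $i$ and is written starting at $c_1=i$, the other cycles are written starting at their smallest elements $c_2<c_3<\dots<c_r$, and $P_t=m_{c_t,\sigma(c_t)}\,m_{\sigma(c_t),\sigma^2(c_t)}\cdots m_{\sigma^{l_t}(c_t),c_t}$, where $l_t+1$ is the length of $C_t$. The *column determinant* is, with the same notation, $$\operatorname{cdet}_i M=\sum_{\sigma}(-1)^{n-r}\,Q_rQ_{r-1}\cdots Q_1,\qquad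 Q_t=m_{c_t,\sigma^{l_t}(c_t)}\cdots m_{\sigma^2(c_t),\sigma(c_t)}\,m_{\sigma(c_t),c_t}.$$ If $M$ is Hermitian, all $\operatorname{rdet}_iM$ and $\operatorname{cdet}_iM$ have the same real value, denoted $\det M$ (for definiteness: $\operatorname{rdet}_i M$ with $i$ the smallest index); the determinant of the empty matrix is $1$. Further, $M_{.i}(v)$ (resp. $M_{i.}(v)$) is $M$ with its $i$-th column (resp. row) replaced by $v$; $M_\alpha^\alpha$ is the principal submatrix with rows and columns in $\alpha$, which keep their original indices; $J_{r,n}$ is the set of $r$-element subsets of $\{1,\dots,n\}$, and $J_{r,n}\{i\}$ the set of those that contain $i$. If $A\in\mathbb H^{m\times n}$ has rank $n$, put $\operatorname{ddet}A=\det(A^*A)$; if $B\in\mathbb H^{p\times q}$ has rank $p$, put $\operatorname{ddet}B=\det(BB^*)$. **Theorem.** Let $A\in\mathbb H^{m\times n}$, $B\in\mathbb H^{p\times q}$, $D\in\mathbb H^{m\times q}$. Among the $X\in\mathbb H^{n\times p}$ that minimize $\|AXB-D\|$ there is exactly one of minimum norm, $X_{LS}=(x_{ij})$, and $X_{LS}=A^+DB^+$.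 Put $r_1=\operatorname{rank}A$, $r_2=\operatorname{rank}B$, let $\widetilde D=A^*DB^*$, with rows $\tilde d_{k.}$ $(1\le k\le n)$ and columns $\tilde d_{.l}$ $(1\le l\le p)$, and put $$S_A=\sum_{\beta\in J_{r_1,n}}\det\big((A^*A)_\beta^\beta\big),\qquad S_B=\sum_{\alpha\in J_{r_2,p}}\det\big((BB^*)_\alpha^\alpha\big).$$ Define the column vectors $d^B_{.j}$, $\mathring d^B_{.j}$ of length $n$ and the row vectors $d^A_{i.}$, $\mathring d^A_{i.}$ of length $p$ by $$(d^B_{.j})_k=\sum_{\alpha\in J_{r_2,p}\{j\}}\operatorname{rdet}_j\big(((BB^*)_{j.}(\tilde d_{k.}))_\alpha^\alpha\big),\qquad (\mathring d^B_{.j})_k=\operatorname{rdet}_j\big((BB^*)_{j.}(\tilde d_{k.})\big),$$ $$(d^A_{i.})_l=\sum_{\beta\in J_{r_1,n}\{i\}}\operatorname{cdet}_i\big(((A^*A)_{.i}(\tilde d_{.l}))_\beta^\beta\big),\qquad (\mathring d^A_{i.})_l=\operatorname{cdet}_i\big((A^*A)_{.i}(\tilde d_{.l})\big).$$ Then the denominators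 below do not vanish, and for all $i=1,\dots,n$, $j=1,\dots,p$: (i) for arbitrary ranks (in particular if $r_1<n$ and $r_2<p$), $$x_{ij}=\frac{\sum_{\beta\in J_{r_1,n}\{i\}}\operatorname{cdet}_i\big(((A^*A)_{.i}(d^B_{.j}))_\beta^\beta\big)}{S_A\,S_B}=\frac{\sum_{\alpha\in J_{r_2,p}\{j\}}\operatorname{rdet}_j\big(((BB^*)_{j.}(d^A_{i.}))_\alpha^\alpha\big)}{S_A\,S_B};$$ (ii) if $r_1=n$ and $r_2=p$, $$x_{ij}=\frac{\operatorname{cdet}_i\big((A^*A)_{.i}(\mathring d^B_{.j})\big)}{\operatorname{ddet}A\cdot\operatorname{ddet}B}=\frac{\operatorname{rdet}_j\big((BB^*)_{j.}(\mathring d^A_{i.})\big)}{\operatorname{ddet}A\cdot\operatorname{ddet}B};$$ (iii) if $r_1=n$ and $r_2<p$, $$x_{ij}=\frac{\operatorname{cdet}_i\big((A^*A)_{.i}(d^B_{.j})\big)}{\operatorname{ddet}A\cdot S_B}=\frac{\sum_{\alpha\in J_{r_2,p}\{j\}}\operatorname{rdet}_j\big(((BB^*)_{j.}(\mathring d^A_{i.}))_\alpha^\alpha\big)}{\operatorname{ddet}A\cdot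 S_B};$$ (iv) if $r_1<n$ and $r_2=p$, $$x_{ij}=\frac{\operatorname{rdet}_j\big((BB^*)_{j.}(d^A_{i.})\big)}{S_A\cdot\operatorname{ddet}B}=\frac{\sum_{\beta\in J_{r_1,n}\{i\}}\operatorname{cdet}_i\big(((A^*A)_{.i}(\mathring d^B_{.j}))_\beta^\beta\big)}{S_A\cdot\operatorname{ddet}B}.$$ -/

import Mathlib

open scoped Quaternion Matrix

section Determinants

variable {ι R : Type*} [Fintype ι] [LinearOrder ι] [Ring R]

/-- The number of elements of the cycle of `σ` through `c` (equal to `1` if `c` is a fixed point). -/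
def cycleLength (σ : Equiv.Perm ι) (c : ι) : ℕ :=
  (Finset.univ.filter fun d => σ.SameCycle c d).card

/-- The smallest elements of those cycles of `σ` (fixed points included) that do not contain `i`,
listed in increasing order. -/
def otherLeaders (σ : Equiv.Perm ι) (i : ι) : List ι :=
  (Finset.univ.filter fun c => ¬ σ.SameCycle i c ∧ ∀ d, σ.SameCycle c d → c ≤ d).sort (· ≤ ·)

/-- For the cycle `(c, σ c, …, σ ^ l c)` of `σ`, the ordered product
`a_{c, σ c} * a_{σ c, σ² c} * ⋯ * a_{σ ^ l c, c}`. -/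
def rowCycleProd (A : Matrix ι ι R) (σ : Equiv.Perm ι) (c : ι) : R :=
  ((List.range (cycleLength σ c)).map fun k => A ((σ ^ k) c) ((σ ^ (k + 1)) c)).prod

/-- For the cycle `(τ ^ l c, …, τ c, c)` of `τ`, the ordered product
`a_{c, τ ^ l c} * ⋯ * a_{τ² c, τ c} * a_{τ c, c}`. -/
def colCycleProd (A : Matrix ι ι R) (τ : Equiv.Perm ι) (c : ι) : R :=
  ((List.range (cycleLength τ c)).reverse.map fun k => A ((τ ^ (k + 1)) c) ((τ ^ k) c)).prod

/-- The `i`-th row determinant `rdet_i A`: in the monomial of `σ`, the cycle through `i` comes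
first (leftmost) and starts with `i`; the other cycles start with their smallest elements and
follow from left to right with increasing smallest elements. The sign of `σ` is `(-1) ^ (n - r)`,
where `n` is the size of the matrix and `r` the number of cycles of `σ`, fixed points included. -/
def rdet (i : ι) (A : Matrix ι ι R) : R :=
  ∑ σ : Equiv.Perm ι, Equiv.Perm.sign σ •
    (rowCycleProd A σ i * ((otherLeaders σ i).map (rowCycleProd A σ)).prod)

/-- The `j`-th column determinant `cdet_j A`: in the monomial of `τ`, the cycle through `j` comes
last (rightmost) and is read from right to left starting with `j`; the other cycles are read from
right to left starting with their smallest elements, and follow from right to left with increasing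
smallest elements. -/
def cdet (j : ι) (A : Matrix ι ι R) : R :=
  ∑ τ : Equiv.Perm ι, Equiv.Perm.sign τ •
    (((otherLeaders τ j).reverse.map (colCycleProd A τ)).prod * colCycleProd A τ j)

/-- The determinant of a Hermitian matrix. All `rdet_i A` and `cdet_i A` of a Hermitian quaternion
matrix `A` have the same (real) value, the determinant of `A`; we take the one for the smallest
index. The determinant of the empty matrix is `1`. The function is used for Hermitian matrices
only. -/
def hermDet (A : Matrix ι ι R) : R :=
  if h : (Finset.univ : Finset ι).Nonempty then rdet (Finset.univ.min' h) A else 1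

/-- The principal submatrix with rows and columns in `α`, in their original order. -/
def principalSub (A : Matrix ι ι R) (α : Finset ι) : Matrix {x // x ∈ α} {x // x ∈ α} R :=
  A.submatrix Subtype.val Subtype.val

/-- The sum of all principal minors of order `r` of a Hermitian matrix. -/
def minorSum (r : ℕ) (A : Matrix ι ι R) : R :=
  ∑ α : {α : Finset ι // α.card = r}, hermDet (principalSub A α.1)

/-- The sum of `rdet_j` of the principal submatrices of order `r` that involve the row `j`. Here
`rdet_j` refers to the original index `j` and not to its position in the submatrix. -/
def rdetSum (r : ℕ) (j : ι) (A : Matrix ι ι R) : R :=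
  ∑ α : {α : Finset ι // α.card = r ∧ j ∈ α}, rdet ⟨j, α.2.2⟩ (principalSub A α.1)

/-- The sum of `cdet_i` of the principal submatrices of order `r` that involve the column `i`. Here
`cdet_i` refers to the original index `i` and not to its position in the submatrix. -/
def cdetSum (r : ℕ) (i : ι) (A : Matrix ι ι R) : R :=
  ∑ β : {β : Finset ι // β.card = r ∧ i ∈ β}, cdet ⟨i, β.2.2⟩ (principalSub A β.1)

end Determinants

/-- The rank of a quaternion matrix: the dimension of the right vector space over the quaternions
that is spanned by its columns. -/
noncomputable def quatRank {m n : ℕ} (A : Matrix (Fin m) (Fin n) ℍ[ℝ]) : ℕ :=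
  Module.finrank ℍ[ℝ]ᵐᵒᵖ (Submodule.span ℍ[ℝ]ᵐᵒᵖ (Set.range A.col))

/-- `P` is the Moore-Penrose inverse of `A`: the four Penrose conditions. -/
structure IsMoorePenrose {m n : ℕ} (A : Matrix (Fin m) (Fin n) ℍ[ℝ])
    (P : Matrix (Fin n) (Fin m) ℍ[ℝ]) : Prop where
  left_herm : (A * P)ᴴ = A * P
  right_herm : (P * A)ᴴ = P * A
  inner_inv : A * P * A = A
  outer_inv : P * A * P = P

section LeastSquares

attribute [local instance] Matrix.frobeniusNormedAddCommGroup

variable {m n p q : ℕ}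

/-- `X` minimizes the Frobenius norm of `A X B - D`. -/
def IsLeastSquares (A : Matrix (Fin m) (Fin n) ℍ[ℝ]) (B : Matrix (Fin p) (Fin q) ℍ[ℝ])
    (D : Matrix (Fin m) (Fin q) ℍ[ℝ]) (X : Matrix (Fin n) (Fin p) ℍ[ℝ]) : Prop :=
  ∀ Y : Matrix (Fin n) (Fin p) ℍ[ℝ], ‖A * X * B - D‖ ≤ ‖A * Y * B - D‖

/-- `X` has the smallest Frobenius norm among the least squares solutions of `A X B = D`. -/
def IsMinNormLeastSquares (A : Matrix (Fin m) (Fin n) ℍ[ℝ]) (B : Matrix (Fin p) (Fin q) ℍ[ℝ])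
    (D : Matrix (Fin m) (Fin q) ℍ[ℝ]) (X : Matrix (Fin n) (Fin p) ℍ[ℝ]) : Prop :=
  IsLeastSquares A B D X ∧
    ∀ Y : Matrix (Fin n) (Fin p) ℍ[ℝ], IsLeastSquares A B D Y → ‖X‖ ≤ ‖Y‖

end LeastSquares

section AuxiliaryVectors

variable {m n p q : ℕ}

/-- The matrix `D̃ = A* D B*`. -/
noncomputable def tildeD (A : Matrix (Fin m) (Fin n) ℍ[ℝ]) (B : Matrix (Fin p) (Fin q) ℍ[ℝ])
    (D : Matrix (Fin m) (Fin q) ℍ[ℝ]) : Matrix (Fin n) (Fin p) ℍ[ℝ] :=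
  Aᴴ * D * Bᴴ

/-- The column vector `d^B_{.j}` for `B` of rank `r`: its `k`-th entry is the sum of
`rdet_j (((B B*)_{j.} (d̃_{k.}))_α^α)` over the `α` of size `r` with `j ∈ α`. -/
noncomputable def dB (r : ℕ) (A : Matrix (Fin m) (Fin n) ℍ[ℝ]) (B : Matrix (Fin p) (Fin q) ℍ[ℝ])
    (D : Matrix (Fin m) (Fin q) ℍ[ℝ]) (j : Fin p) : Fin n → ℍ[ℝ] :=
  fun k => rdetSum r j ((B * Bᴴ).updateRow j ((tildeD A B D).row k))

/-- The row vector `d^A_{i.}` for `A` of rank `r`: its `l`-th entry is the sum of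
`cdet_i (((A* A)_{.i} (d̃_{.l}))_β^β)` over the `β` of size `r` with `i ∈ β`. -/
noncomputable def dA (r : ℕ) (A : Matrix (Fin m) (Fin n) ℍ[ℝ]) (B : Matrix (Fin p) (Fin q) ℍ[ℝ])
    (D : Matrix (Fin m) (Fin q) ℍ[ℝ]) (i : Fin n) : Fin p → ℍ[ℝ] :=
  fun l => cdetSum r i ((Aᴴ * A).updateCol i ((tildeD A B D).col l))

/-- The column vector `d^B_{.j}` for `B` of full row rank: its `k`-th entry is
`rdet_j ((B B*)_{j.} (d̃_{k.}))`. -/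
noncomputable def dBfull (A : Matrix (Fin m) (Fin n) ℍ[ℝ]) (B : Matrix (Fin p) (Fin q) ℍ[ℝ])
    (D : Matrix (Fin m) (Fin q) ℍ[ℝ]) (j : Fin p) : Fin n → ℍ[ℝ] :=
  fun k => rdet j ((B * Bᴴ).updateRow j ((tildeD A B D).row k))

/-- The row vector `d^A_{i.}` for `A` of full column rank: its `l`-th entry is
`cdet_i ((A* A)_{.i} (d̃_{.l}))`. -/
noncomputable def dAfull (A : Matrix (Fin m) (Fin n) ℍ[ℝ]) (B : Matrix (Fin p) (Fin q) ℍ[ℝ])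
    (D : Matrix (Fin m) (Fin q) ℍ[ℝ]) (i : Fin n) : Fin p → ℍ[ℝ] :=
  fun l => cdet i ((Aᴴ * A).updateCol i ((tildeD A B D).col l))

end AuxiliaryVectors

/-! Let M stand for A*A (BB* is treated the same way). Sorting the permutations by what they do at
the distinguished index i gives rdet_i M = m_ii det M' − Σ_c m_ic rdet_c(M' with column c replaced
by column i of M), where M' is M without row and column i (`rdet_eq_sub_sum`). This recursion stays
among principal minors with one replaced column, so the later arguments are inductions on index sets
rather than on permutations. For positive definite Hermitian matrices, elimination with real
positive Schur complements turns it into Cramer's rule for right and left systems, with the same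
determinant for every distinguished index (`PosDefOn.exists_cramerOn`, `PosDefOn.rowMinor_eq`).

A singular M is reached through M + tI with t > 0. Its determinant is Σ t^(n-s) e_s, with e_s the
sum of the principal minors of order s, and its cofactor matrix is Σ t^(n-s) C_s, with C_s =
`cofactorMatrix s M`. Comparing coefficients in (M + tI) · cofactors = det · I yields M C_s +
C_{s+1} = e_s I. Hence each C_s is a real polynomial in M, so it is Hermitian and commutes with M.
If r is the rank, then e_r ≠ 0 and e_s = 0 for s > r, and descending from the top gives M² C_r = e_r
M. The Penrose conditions follow for e_r⁻¹ C_r A* (`exists_cofactor_data`).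

Both numerators in the theorem are the (i, j) entry of one product, C_r of A*A times D̃ times C_r of
BB*, each C_r at its own rank. This product is S_A S_B A⁺DB⁺. That A⁺DB⁺ is the unique minimum norm
least squares solution is Pythagoras applied twice (`isMinNormLeastSquares_iff`). -/

open Equiv.Perm (SameCycle)
set_option linter.unusedSectionVars false

/-! ### Cycles of a permutation and adjoining one point to an ordered set. -/

section Cycles

variable {ι κ : Type*} [Fintype ι] [LinearOrder ι] [Fintype κ] [LinearOrder κ]

theorem cycleLength_eq_minimalPeriod (σ : Equiv.Perm ι) (c : ι) :
    cycleLength σ c = Function.minimalPeriod σ c := by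
  classical
  have h := MulAction.minimalPeriod_eq_card σ c
  have h' : (fun x => σ • x) = σ := rfl
  rw [h'] at h
  rw [h, cycleLength, ← Set.toFinset_card]
  congr 1
  ext d
  simp only [Finset.mem_filter, Finset.mem_univ, true_and, Set.mem_toFinset]
  constructor
  · rintro ⟨k, rfl⟩
    exact ⟨⟨σ ^ k, k, rfl⟩, rfl⟩
  · rintro ⟨⟨_, k, rfl⟩, rfl⟩
    exact ⟨k, rfl⟩

theorem pow_cycleLength_apply (σ : Equiv.Perm ι) (c : ι) : (σ ^ cycleLength σ c) c = c := by
  rw [cycleLength_eq_minimalPeriod, Equiv.Perm.coe_pow]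
  exact Function.isPeriodicPt_minimalPeriod σ c

theorem pow_apply_ne_of_lt_cycleLength (σ : Equiv.Perm ι) (c : ι) {k : ℕ} (hk : k ≠ 0)
    (h : k < cycleLength σ c) : (σ ^ k) c ≠ c := by
  rw [cycleLength_eq_minimalPeriod] at h
  intro h'
  exact Function.not_isPeriodicPt_of_pos_of_lt_minimalPeriod hk h
    (by rw [Equiv.Perm.coe_pow] at h'; exact h')

/-- The map need not intertwine the permutations: it suffices that a point and its successor land in
one cycle. This covers both the inclusion f, which skips the inserted point, and the retraction,
which merges it with c. -/
theorem sameCycle_map_of_step {σ : Equiv.Perm ι} {τ : Equiv.Perm κ} (g : ι → κ)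
    (h : ∀ x, τ.SameCycle (g x) (g (σ x))) {x y : ι} (hxy : σ.SameCycle x y) :
    τ.SameCycle (g x) (g y) := by
  obtain ⟨n, -, -, rfl⟩ := hxy.exists_pow_eq
  induction n with
  | zero => exact SameCycle.refl _ _
  | succ n ih =>
    rw [pow_succ', Equiv.Perm.mul_apply]
    exact (ih ⟨n, by simp⟩).trans (h _)

/-- A type with one point `i` added to the range of an embedding, as an `Option` type. -/
noncomputable def optionEquivOfRange (f : κ ↪o ι) (i : ι) (hf : ∀ x, x ≠ i ↔ x ∈ Set.range f) :
    Option κ ≃ ι :=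
  Equiv.ofBijective (fun o => o.elim i f) (by
    have hne : ∀ c, f c ≠ i := fun c => (hf _).2 ⟨c, rfl⟩
    constructor
    · rintro (_ | a) (_ | b) h
      · rfl
      · exact absurd h.symm (hne b)
      · exact absurd h (hne a)
      · exact congrArg some (f.injective h)
    · intro x
      by_cases hx : x = i
      · exact ⟨none, hx.symm⟩
      · obtain ⟨c, hc⟩ := (hf x).1 hx
        exact ⟨some c, hc⟩)

@[simp] theorem optionEquivOfRange_none (f : κ ↪o ι) (i : ι)
    (hf : ∀ x, x ≠ i ↔ x ∈ Set.range f) : optionEquivOfRange f i hf none = i := rfl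

@[simp] theorem optionEquivOfRange_some (f : κ ↪o ι) (i : ι)
    (hf : ∀ x, x ≠ i ↔ x ∈ Set.range f) (c : κ) : optionEquivOfRange f i hf (some c) = f c := rfl

end Cycles

/-! ### Expansion of row determinants by deleting the distinguished index. -/

section Extend

variable {ι κ R : Type*} [Fintype ι] [LinearOrder ι] [Fintype κ] [LinearOrder κ] [Ring R]

theorem rowCycleProd_congr {A : Matrix ι ι R} {B : Matrix κ κ R} {σ : Equiv.Perm ι}
    {τ : Equiv.Perm κ} {x : ι} {y : κ} (hl : cycleLength σ x = cycleLength τ y)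
    (h : ∀ k, A ((σ ^ k) x) ((σ ^ (k + 1)) x) = B ((τ ^ k) y) ((τ ^ (k + 1)) y)) :
    rowCycleProd A σ x = rowCycleProd B τ y := by
  rw [rowCycleProd, rowCycleProd, hl]
  exact congrArg List.prod (List.map_congr_left fun k _ => h k)

/-- `σ` arises from `τ` by adding the fixed point `i`. -/
structure IsFixedExt (f : κ ↪o ι) (i : ι) (σ : Equiv.Perm ι) (τ : Equiv.Perm κ) : Prop where
  ne_iff : ∀ x, x ≠ i ↔ x ∈ Set.range f
  apply_pt : σ i = i
  apply_map : ∀ x, σ (f x) = f (τ x)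

/-- `σ` arises from `τ` by inserting `i` in front of `c` in the cycle of `τ` through `c`. -/
structure IsInsertExt (f : κ ↪o ι) (i : ι) (σ : Equiv.Perm ι) (τ : Equiv.Perm κ) (c : κ) :
    Prop where
  ne_iff : ∀ x, x ≠ i ↔ x ∈ Set.range f
  apply_pt : σ i = f c
  apply_map : ∀ x, σ (f x) = if τ x = c then i else f (τ x)

theorem IsFixedExt.pow_map {f : κ ↪o ι} {i : ι} {σ : Equiv.Perm ι} {τ : Equiv.Perm κ}
    (H : IsFixedExt f i σ τ) (k : ℕ) (x : κ) : (σ ^ k) (f x) = f ((τ ^ k) x) := by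
  induction k with
  | zero => rfl
  | succ k ih => rw [pow_succ', pow_succ', Equiv.Perm.mul_apply, ih, H.apply_map]; rfl

theorem IsFixedExt.sameCycle_pt {f : κ ↪o ι} {i : ι} {σ : Equiv.Perm ι} {τ : Equiv.Perm κ}
    (H : IsFixedExt f i σ τ) {x : ι} : σ.SameCycle i x ↔ x = i := by
  constructor
  · intro h
    obtain ⟨n, -, -, rfl⟩ := h.exists_pow_eq
    exact Equiv.Perm.pow_apply_eq_self_of_apply_eq_self H.apply_pt n
  · rintro rfl
    exact SameCycle.refl _ _

theorem IsFixedExt.sameCycle_map {f : κ ↪o ι} {i : ι} {σ : Equiv.Perm ι} {τ : Equiv.Perm κ}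
    (H : IsFixedExt f i σ τ) {x y : κ} : σ.SameCycle (f x) (f y) ↔ τ.SameCycle x y := by
  constructor
  · intro h
    obtain ⟨n, -, -, h⟩ := h.exists_pow_eq
    rw [H.pow_map] at h
    exact ⟨n, by simpa using f.injective h⟩
  · intro h
    obtain ⟨n, -, -, rfl⟩ := h.exists_pow_eq
    exact ⟨n, by simpa using H.pow_map n x⟩

theorem card_filter_eq_of_range (f : κ ↪o ι) (i : ι) (hf : ∀ x, x ≠ i ↔ x ∈ Set.range f)
    (p : ι → Prop) [DecidablePred p] [DecidablePred fun x => p (f x)] :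
    (Finset.univ.filter p).card =
      (if p i then 1 else 0) + (Finset.univ.filter fun x => p (f x)).card := by
  rw [Finset.card_filter, Finset.card_filter, ← (optionEquivOfRange f i hf).sum_comp,
    Fintype.sum_option]
  simp only [optionEquivOfRange_none, optionEquivOfRange_some]
  congr 1
  exact Finset.sum_congr rfl fun c _ => by by_cases h : p (f c) <;> simp [h]

theorem IsFixedExt.cycleLength_map {f : κ ↪o ι} {i : ι} {σ : Equiv.Perm ι} {τ : Equiv.Perm κ}
    (H : IsFixedExt f i σ τ) (x : κ) : cycleLength σ (f x) = cycleLength τ x := by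
  rw [cycleLength, card_filter_eq_of_range f i H.ne_iff, if_neg, zero_add, cycleLength]
  · simp only [H.sameCycle_map]
  · rw [Equiv.Perm.sameCycle_comm, H.sameCycle_pt]
    exact (H.ne_iff _).2 ⟨x, rfl⟩

theorem IsFixedExt.rowCycleProd_map {f : κ ↪o ι} {i : ι} {σ : Equiv.Perm ι} {τ : Equiv.Perm κ}
    (H : IsFixedExt f i σ τ) (A : Matrix ι ι R) (x : κ) :
    rowCycleProd A σ (f x) = rowCycleProd (A.submatrix f f) τ x :=
  rowCycleProd_congr (H.cycleLength_map x) fun k => by simp only [H.pow_map]; rfl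

theorem IsFixedExt.rowCycleProd_pt {f : κ ↪o ι} {i : ι} {σ : Equiv.Perm ι} {τ : Equiv.Perm κ}
    (H : IsFixedExt f i σ τ) (A : Matrix ι ι R) : rowCycleProd A σ i = A i i := by
  have hl : cycleLength σ i = 1 := by
    rw [cycleLength, Finset.card_eq_one]
    exact ⟨i, by ext x; simp [H.sameCycle_pt]⟩
  simp [rowCycleProd, hl, H.apply_pt]

theorem IsFixedExt.otherLeaders_pt {f : κ ↪o ι} {i : ι} {σ : Equiv.Perm ι} {τ : Equiv.Perm κ}
    (H : IsFixedExt f i σ τ) : otherLeaders σ i =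
      ((Finset.univ.filter fun c => ∀ d, τ.SameCycle c d → c ≤ d).sort (· ≤ ·)).map f := by
  have := Finset.map_sort f.toEmbedding (Finset.univ.filter fun c => ∀ d, τ.SameCycle c d → c ≤ d)
    (· ≤ ·) (· ≤ ·) (fun a _ b _ => f.le_iff_le.symm)
  refine Eq.trans ?_ this.symm
  rw [otherLeaders]
  congr 1
  ext x
  simp only [Finset.mem_filter, Finset.mem_univ, true_and, Finset.mem_map, H.sameCycle_pt]
  constructor
  · rintro ⟨h1, h2⟩
    obtain ⟨y, rfl⟩ := (H.ne_iff x).1 h1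
    exact ⟨y, fun d hd => f.le_iff_le.1 (h2 _ (H.sameCycle_map.2 hd)), rfl⟩
  · rintro ⟨y, hy, rfl⟩
    have hne : f y ≠ i := (H.ne_iff _).2 ⟨y, rfl⟩
    refine ⟨hne, fun d hd => ?_⟩
    by_cases hdi : d = i
    · subst hdi
      exact absurd (H.sameCycle_pt.1 hd.symm) hne
    · obtain ⟨e, rfl⟩ := (H.ne_iff d).1 hdi
      exact f.le_iff_le.2 (hy e (H.sameCycle_map.1 hd))

/-- The least index leads its own cycle and precedes every other leader, so for this index the
special rule of the row determinant coincides with plain increasing order. -/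
theorem leaders_eq_min_cons (τ : Equiv.Perm κ) (h : (Finset.univ : Finset κ).Nonempty) :
    (Finset.univ.filter fun c => ∀ d, τ.SameCycle c d → c ≤ d).sort (· ≤ ·) =
      Finset.univ.min' h :: otherLeaders τ (Finset.univ.min' h) := by
  rw [otherLeaders, ← Finset.sort_insert]
  · congr 1
    ext c
    simp only [Finset.mem_filter, Finset.mem_univ, true_and, Finset.mem_insert]
    constructor
    · intro hc
      by_cases hm : τ.SameCycle (Finset.univ.min' h) c
      · exact Or.inl (le_antisymm (hc _ hm.symm) (Finset.min'_le _ _ (Finset.mem_univ _)))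
      · exact Or.inr ⟨hm, hc⟩
    · rintro (rfl | ⟨-, hc⟩)
      · exact fun d _ => Finset.min'_le _ _ (Finset.mem_univ _)
      · exact hc
  · exact fun b _ => Finset.min'_le _ _ (Finset.mem_univ _)
  · simp [SameCycle.refl]

/-- The retraction g collapses i onto c; up to this identification, inserting i leaves the partition
into cycles unchanged. -/
theorem IsInsertExt.sameCycle_iff {f : κ ↪o ι} {i : ι} {σ : Equiv.Perm ι} {τ : Equiv.Perm κ}
    {c : κ} (H : IsInsertExt f i σ τ c) {g : ι → κ} (gi : g i = c) (gf : ∀ x, g (f x) = x)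
    {x y : ι} : σ.SameCycle x y ↔ τ.SameCycle (g x) (g y) := by
  have hgf : ∀ x, σ.SameCycle x (f (g x)) := by
    intro x
    by_cases hx : x = i
    · subst hx
      rw [gi, ← H.apply_pt]
      exact ⟨1, by simp⟩
    · obtain ⟨y, rfl⟩ := (H.ne_iff x).1 hx
      rw [gf]
  constructor
  · refine sameCycle_map_of_step g fun x => ?_
    by_cases hx : x = i
    · subst hx
      rw [H.apply_pt, gf, gi]
    · obtain ⟨y, rfl⟩ := (H.ne_iff x).1 hx
      rw [H.apply_map, gf]
      split_ifs with h
      · rw [gi, ← h]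
        exact ⟨1, by simp⟩
      · rw [gf]
        exact ⟨1, by simp⟩
  · intro h
    refine (hgf x).trans (SameCycle.trans ?_ (hgf y).symm)
    refine sameCycle_map_of_step f (fun z => ?_) h
    by_cases hz : τ z = c
    · rw [hz, ← H.apply_pt]
      refine ⟨2, ?_⟩
      have := H.apply_map z
      rw [if_pos hz] at this
      rw [← this]
      rfl
    · refine ⟨1, ?_⟩
      have := H.apply_map z
      rw [if_neg hz] at this
      rw [← this, zpow_one]

theorem IsInsertExt.exists_retraction {f : κ ↪o ι} {i : ι} {σ : Equiv.Perm ι}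
    {τ : Equiv.Perm κ} {c : κ} (H : IsInsertExt f i σ τ c) :
    ∃ g : ι → κ, g i = c ∧ ∀ x, g (f x) = x :=
  ⟨fun x => ((optionEquivOfRange f i H.ne_iff).symm x).elim c id, by
    have h : (optionEquivOfRange f i H.ne_iff).symm i = none := by
      rw [Equiv.symm_apply_eq]; rfl
    simp [h], fun x => by
    have h : (optionEquivOfRange f i H.ne_iff).symm (f x) = some x := by
      rw [Equiv.symm_apply_eq]; rfl
    simp [h]⟩

theorem IsInsertExt.sameCycle_map {f : κ ↪o ι} {i : ι} {σ : Equiv.Perm ι} {τ : Equiv.Perm κ}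
    {c : κ} (H : IsInsertExt f i σ τ c) {x y : κ} :
    σ.SameCycle (f x) (f y) ↔ τ.SameCycle x y := by
  obtain ⟨g, gi, gf⟩ := H.exists_retraction
  rw [H.sameCycle_iff gi gf, gf, gf]

theorem IsInsertExt.sameCycle_pt_map {f : κ ↪o ι} {i : ι} {σ : Equiv.Perm ι}
    {τ : Equiv.Perm κ} {c : κ} (H : IsInsertExt f i σ τ c) {y : κ} :
    σ.SameCycle i (f y) ↔ τ.SameCycle c y := by
  obtain ⟨g, gi, gf⟩ := H.exists_retraction
  rw [H.sameCycle_iff gi gf, gf, gi]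

theorem IsInsertExt.cycleLength_pt {f : κ ↪o ι} {i : ι} {σ : Equiv.Perm ι} {τ : Equiv.Perm κ}
    {c : κ} (H : IsInsertExt f i σ τ c) : cycleLength σ i = 1 + cycleLength τ c := by
  rw [cycleLength, card_filter_eq_of_range f i H.ne_iff, if_pos (SameCycle.refl _ _), cycleLength]
  simp only [H.sameCycle_pt_map]

theorem IsInsertExt.cycleLength_map {f : κ ↪o ι} {i : ι} {σ : Equiv.Perm ι} {τ : Equiv.Perm κ}
    {c : κ} (H : IsInsertExt f i σ τ c) {x : κ} (hx : ¬ τ.SameCycle c x) :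
    cycleLength σ (f x) = cycleLength τ x := by
  rw [cycleLength, card_filter_eq_of_range f i H.ne_iff, if_neg, zero_add, cycleLength]
  · simp only [H.sameCycle_map]
  · rw [Equiv.Perm.sameCycle_comm, H.sameCycle_pt_map]
    exact hx

theorem IsInsertExt.pow_map {f : κ ↪o ι} {i : ι} {σ : Equiv.Perm ι} {τ : Equiv.Perm κ}
    {c : κ} (H : IsInsertExt f i σ τ c) {x : κ} (hx : ¬ τ.SameCycle c x) (k : ℕ) :
    (σ ^ k) (f x) = f ((τ ^ k) x) := by
  induction k with
  | zero => rfl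
  | succ k ih =>
    rw [pow_succ', pow_succ', Equiv.Perm.mul_apply, ih, H.apply_map, if_neg]
    · rfl
    · intro h
      exact hx (SameCycle.symm ⟨k + 1, by
        rw [← h, ← Equiv.Perm.mul_apply, ← pow_succ']; norm_cast⟩)

theorem IsInsertExt.pow_succ_pt {f : κ ↪o ι} {i : ι} {σ : Equiv.Perm ι} {τ : Equiv.Perm κ}
    {c : κ} (H : IsInsertExt f i σ τ c) {k : ℕ} (hk : k < cycleLength τ c) :
    (σ ^ (k + 1)) i = f ((τ ^ k) c) := by
  induction k with
  | zero => simpa using H.apply_pt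
  | succ k ih =>
    rw [pow_succ', Equiv.Perm.mul_apply, ih (by omega), H.apply_map, if_neg]
    · rw [pow_succ' τ]; rfl
    · have := pow_apply_ne_of_lt_cycleLength τ c k.succ_ne_zero hk
      rwa [pow_succ', Equiv.Perm.mul_apply] at this

/-- A cycle that avoids c reads nothing from column c, so the replacement column v is arbitrary. -/
theorem IsInsertExt.rowCycleProd_map {f : κ ↪o ι} {i : ι} {σ : Equiv.Perm ι}
    {τ : Equiv.Perm κ} {c : κ} (H : IsInsertExt f i σ τ c) (A : Matrix ι ι R) (v : κ → R) {x : κ}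
    (hx : ¬ τ.SameCycle c x) :
    rowCycleProd A σ (f x) = rowCycleProd ((A.submatrix f f).updateCol c v) τ x :=
  rowCycleProd_congr (H.cycleLength_map hx) fun k => by
    rw [H.pow_map hx, H.pow_map hx, Matrix.updateCol_ne]
    · rfl
    · intro h
      exact hx (SameCycle.symm ⟨(k + 1 : ℕ), by rw [zpow_natCast]; exact h⟩)

/-- After the first step i → c, the cycle follows that of τ, except that it closes up at i instead
of c. Only this last factor lies in column c of the smaller matrix, so replacing that column by
column i corrects exactly it. -/
theorem IsInsertExt.rowCycleProd_pt {f : κ ↪o ι} {i : ι} {σ : Equiv.Perm ι}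
    {τ : Equiv.Perm κ} {c : κ} (H : IsInsertExt f i σ τ c) (A : Matrix ι ι R) :
    rowCycleProd A σ i = A i (f c) *
      rowCycleProd ((A.submatrix f f).updateCol c fun x => A (f x) i) τ c := by
  rw [rowCycleProd, H.cycleLength_pt, add_comm, List.range_succ_eq_map, List.map_cons,
    List.prod_cons, List.map_map, rowCycleProd]
  congr 1
  · simp [H.apply_pt]
  · refine congrArg List.prod (List.map_congr_left fun k hk => ?_)
    rw [List.mem_range] at hk
    simp only [Function.comp, Nat.succ_eq_add_one]
    rw [H.pow_succ_pt hk]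
    by_cases hk' : k + 1 < cycleLength τ c
    · rw [H.pow_succ_pt hk', Matrix.updateCol_ne
        (pow_apply_ne_of_lt_cycleLength τ c k.succ_ne_zero hk')]
      rfl
    · have hk1 : k + 1 = cycleLength τ c := by omega
      have h2 : (σ ^ (k + 1 + 1)) i = i := by
        rw [hk1, add_comm, ← H.cycleLength_pt]
        exact pow_cycleLength_apply σ i
      rw [h2, hk1, pow_cycleLength_apply, Matrix.updateCol_self]

theorem IsInsertExt.otherLeaders_pt {f : κ ↪o ι} {i : ι} {σ : Equiv.Perm ι}
    {τ : Equiv.Perm κ} {c : κ} (H : IsInsertExt f i σ τ c) :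
    otherLeaders σ i = (otherLeaders τ c).map f := by
  have := Finset.map_sort f.toEmbedding
    (Finset.univ.filter fun x => ¬ τ.SameCycle c x ∧ ∀ d, τ.SameCycle x d → x ≤ d)
    (· ≤ ·) (· ≤ ·) (fun a _ b _ => f.le_iff_le.symm)
  refine Eq.trans ?_ this.symm
  rw [otherLeaders]
  congr 1
  ext x
  simp only [Finset.mem_filter, Finset.mem_univ, true_and, Finset.mem_map]
  constructor
  · rintro ⟨h1, h2⟩
    have hx : x ≠ i := by
      rintro rfl
      exact h1 (SameCycle.refl _ _)
    obtain ⟨y, rfl⟩ := (H.ne_iff x).1 hx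
    exact ⟨y, ⟨fun h => h1 (H.sameCycle_pt_map.2 h),
      fun d hd => f.le_iff_le.1 (h2 _ (H.sameCycle_map.2 hd))⟩, rfl⟩
  · rintro ⟨y, ⟨hy1, hy2⟩, rfl⟩
    have hy : ¬ σ.SameCycle i (f y) := fun h => hy1 (H.sameCycle_pt_map.1 h)
    refine ⟨hy, fun d hd => ?_⟩
    have hdi : d ≠ i := by
      rintro rfl
      exact hy hd.symm
    obtain ⟨e, rfl⟩ := (H.ne_iff d).1 hdi
    exact f.le_iff_le.2 (hy2 e (H.sameCycle_map.1 hd))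

theorem isFixedExt_decomposeOption {f : κ ↪o ι} {i : ι} (hf : ∀ x, x ≠ i ↔ x ∈ Set.range f)
    (τ : Equiv.Perm κ) : IsFixedExt f i ((optionEquivOfRange f i hf).permCongr
      (Equiv.Perm.decomposeOption.symm (none, τ))) τ := by
  have hi : (optionEquivOfRange f i hf).symm i = none := by rw [Equiv.symm_apply_eq]; rfl
  have hx : ∀ x, (optionEquivOfRange f i hf).symm (f x) = some x := fun x => by
    rw [Equiv.symm_apply_eq]; rfl
  refine ⟨hf, ?_, fun x => ?_⟩
  · simp [Equiv.permCongr_apply, hi]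
  · simp [Equiv.permCongr_apply, hx]

/-- The pair (some c, τ) encodes τ followed by the transposition of the new point with c: whatever
was sent to c now goes to i, and i goes to c. -/
theorem isInsertExt_decomposeOption {f : κ ↪o ι} {i : ι} (hf : ∀ x, x ≠ i ↔ x ∈ Set.range f)
    (τ : Equiv.Perm κ) (c : κ) : IsInsertExt f i ((optionEquivOfRange f i hf).permCongr
      (Equiv.Perm.decomposeOption.symm (some c, τ))) τ c := by
  have hi : (optionEquivOfRange f i hf).symm i = none := by rw [Equiv.symm_apply_eq]; rfl
  have hx : ∀ x, (optionEquivOfRange f i hf).symm (f x) = some x := fun x => by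
    rw [Equiv.symm_apply_eq]; rfl
  refine ⟨hf, ?_, fun x => ?_⟩
  · simp [Equiv.permCongr_apply, hi]
  · simp only [Equiv.permCongr_apply, hx, Equiv.Perm.decomposeOption_symm_apply,
      Equiv.Perm.mul_apply, Equiv.optionCongr_apply, Option.map_some]
    split_ifs with h
    · simp [h]
    · rw [Equiv.swap_apply_of_ne_of_ne (by simp) (by simpa using h)]
      rfl

theorem hermDet_eq_sum_leaders (A : Matrix κ κ R) : hermDet A = ∑ τ : Equiv.Perm κ,
    Equiv.Perm.sign τ • (((Finset.univ.filter fun c => ∀ d, τ.SameCycle c d → c ≤ d).sort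
      (· ≤ ·)).map (rowCycleProd A τ)).prod := by
  rw [hermDet]
  split_ifs with h
  · rw [rdet]
    refine Finset.sum_congr rfl fun τ _ => ?_
    rw [leaders_eq_min_cons τ h, List.map_cons, List.prod_cons]
  · have : IsEmpty κ := by
      rwa [← not_nonempty_iff, ← Finset.univ_nonempty_iff]
    simp

/-- Expansion of a row determinant along its distinguished row. -/
theorem rdet_eq_sub_sum {f : κ ↪o ι} {i : ι} (hf : ∀ x, x ≠ i ↔ x ∈ Set.range f)
    (A : Matrix ι ι R) : rdet i A = A i i * hermDet (A.submatrix f f) -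
      ∑ c, A i (f c) * rdet c ((A.submatrix f f).updateCol c fun x => A (f x) i) := by
  rw [rdet, ← (optionEquivOfRange f i hf).permCongr.sum_comp,
    ← Equiv.Perm.decomposeOption.symm.sum_comp, Fintype.sum_prod_type, Fintype.sum_option,
    sub_eq_add_neg, ← Finset.sum_neg_distrib]
  congr 1
  · rw [hermDet_eq_sum_leaders, Finset.mul_sum]
    refine Finset.sum_congr rfl fun τ _ => ?_
    have H := isFixedExt_decomposeOption hf τ
    rw [H.otherLeaders_pt, H.rowCycleProd_pt, List.map_map, Equiv.Perm.sign_permCongr,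
      Equiv.Perm.decomposeOption_symm_sign, mul_smul_comm]
    congr 4
    funext x
    exact H.rowCycleProd_map A x
  · refine Finset.sum_congr rfl fun c _ => ?_
    rw [rdet, Finset.mul_sum, ← Finset.sum_neg_distrib]
    refine Finset.sum_congr rfl fun τ _ => ?_
    have H := isInsertExt_decomposeOption hf τ c
    -- Inserting a point into an existing cycle is multiplication by one transposition; this is the
    -- source of the minus sign.
    have hs : Equiv.Perm.sign (Equiv.Perm.decomposeOption.symm (some c, τ)) =
        -Equiv.Perm.sign τ := by
      rw [Equiv.Perm.decomposeOption_symm_apply, Equiv.Perm.sign_mul,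
        Equiv.Perm.sign_swap (by simp), Equiv.optionCongr_sign]
      simp
    rw [H.otherLeaders_pt, H.rowCycleProd_pt, List.map_map, Equiv.Perm.sign_permCongr, hs,
      mul_smul_comm, mul_assoc, Units.smul_def, Units.smul_def, Units.val_neg, neg_smul]
    congr 5
    refine List.map_congr_left fun x hx => ?_
    refine H.rowCycleProd_map A _ ?_
    rw [otherLeaders, Finset.mem_sort, Finset.mem_filter] at hx
    exact hx.2.1

theorem star_list_prod [StarRing R] (l : List R) : star l.prod = (l.map star).reverse.prod := by
  induction l with
  | nil => simp
  | cons a l ih => simp [ih]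

theorem star_rowCycleProd_conjTranspose [StarRing R] (A : Matrix ι ι R) (σ : Equiv.Perm ι)
    (c : ι) : star (rowCycleProd Aᴴ σ c) = colCycleProd A σ c := by
  rw [rowCycleProd, colCycleProd, star_list_prod, List.map_map, ← List.map_reverse]
  congr 1
  simp [Function.comp_def]

/-- Conjugation reverses products, which is precisely the passage from the row to the column
ordering of cycles. Column determinants therefore need no expansion of their own. -/
theorem cdet_eq_star_rdet [StarRing R] (j : ι) (A : Matrix ι ι R) :
    cdet j A = star (rdet j Aᴴ) := by
  rw [cdet, rdet, star_sum]
  refine Finset.sum_congr rfl fun σ _ => ?_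
  rw [Units.smul_def, Units.smul_def, star_zsmul, star_mul, star_rowCycleProd_conjTranspose,
    star_list_prod, List.map_map, ← List.map_reverse]
  simp [Function.comp_def, star_rowCycleProd_conjTranspose]

end Extend

/-! ### Recursions for principal minors with one replaced row or column. -/

section PrincipalMinors

variable {ι R : Type*} [Fintype ι] [LinearOrder ι] [Ring R]

/-- The principal minor of `A` with rows and columns in `α`. -/
def principalMinor (A : Matrix ι ι R) (α : Finset ι) : R :=
  hermDet (principalSub A α)

/-- The row determinant `rdet_a` of the principal submatrix of `A` on `α` after its column `a` has
been replaced by `x`, and `0` if `a ∉ α`. -/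
def colMinor (A : Matrix ι ι R) (α : Finset ι) (a : ι) (x : ι → R) : R :=
  if h : a ∈ α then rdet ⟨a, h⟩ ((principalSub A α).updateCol ⟨a, h⟩ fun k => x k) else 0

/-- The row determinant `rdet_a` of the principal submatrix of `A` on `α` after its row `a` has
been replaced by `v`, expanded along that row. -/
def rowMinor (A : Matrix ι ι R) (α : Finset ι) (a : ι) (v : ι → R) : R :=
  v a * principalMinor A (α.erase a) -
    ∑ c ∈ α.erase a, v c * colMinor A (α.erase a) c fun k => A k a

/-- The inclusion of `α.erase a` into `α`. -/
def eraseEmb (α : Finset ι) (a : ι) : {x // x ∈ α.erase a} ↪o {x // x ∈ α} where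
  toFun x := ⟨x, Finset.mem_of_mem_erase x.2⟩
  inj' _ _ h := Subtype.ext (congrArg (fun z : {x // x ∈ α} => (z : ι)) h)
  map_rel_iff' := Iff.rfl

theorem ne_iff_mem_range_eraseEmb (α : Finset ι) (a : {x // x ∈ α}) (x : {x // x ∈ α}) :
    x ≠ a ↔ x ∈ Set.range (eraseEmb α (a : ι)) := by
  constructor
  · intro h
    exact ⟨⟨x, Finset.mem_erase.2 ⟨fun h' => h (Subtype.ext h'), x.2⟩⟩, rfl⟩
  · rintro ⟨y, rfl⟩ h
    exact (Finset.mem_erase.1 y.2).1 (congrArg Subtype.val h)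

theorem colMinor_of_mem (A : Matrix ι ι R) {α : Finset ι} {a : ι} (h : a ∈ α) (x : ι → R) :
    colMinor A α a x = rdet ⟨a, h⟩ ((principalSub A α).updateCol ⟨a, h⟩ fun k => x k) :=
  dif_pos h

theorem colMinor_of_notMem (A : Matrix ι ι R) {α : Finset ι} {a : ι} (h : a ∉ α) (x : ι → R) :
    colMinor A α a x = 0 :=
  dif_neg h

theorem rdet_principalSub (A : Matrix ι ι R) {α : Finset ι} {a : ι} (h : a ∈ α) :
    rdet ⟨a, h⟩ (principalSub A α) = rowMinor A α a (A a) := by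
  rw [rdet_eq_sub_sum (ne_iff_mem_range_eraseEmb α ⟨a, h⟩), rowMinor]
  congr 1
  rw [← Finset.sum_coe_sort (α.erase a)]
  refine Finset.sum_congr rfl fun c _ => ?_
  rw [colMinor_of_mem A c.2]
  rfl

theorem rowMinor_congr {A B : Matrix ι ι R} (α : Finset ι) (a : ι)
    (h : ∀ k l, k ≠ a → A k l = B k l) (v : ι → R) : rowMinor A α a v = rowMinor B α a v := by
  have h1 : principalSub A (α.erase a) = principalSub B (α.erase a) := by
    ext k l
    exact h _ _ (Finset.ne_of_mem_erase k.2)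
  rw [rowMinor, rowMinor, principalMinor, principalMinor, h1]
  congr 1
  refine Finset.sum_congr rfl fun c hc => ?_
  rw [colMinor_of_mem _ hc, colMinor_of_mem _ hc, h1]
  congr 4
  funext k
  exact h _ _ (Finset.ne_of_mem_erase k.2)

/-- The recursion closes up: column a is deleted, but its entries x reappear as the replacement for
column c, so the same x is carried down through all sizes. -/
theorem colMinor_eq (A : Matrix ι ι R) {α : Finset ι} {a : ι} (h : a ∈ α) (x : ι → R) :
    colMinor A α a x = x a * principalMinor A (α.erase a) -
      ∑ c ∈ α.erase a, A a c * colMinor A (α.erase a) c x := by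
  rw [colMinor_of_mem A h, rdet_eq_sub_sum (ne_iff_mem_range_eraseEmb α ⟨a, h⟩)]
  have hne : ∀ c : {x // x ∈ α.erase a}, eraseEmb α a c ≠ ⟨a, h⟩ := fun c hc =>
    Finset.ne_of_mem_erase c.2 (congrArg Subtype.val hc)
  have hsub : ((principalSub A α).updateCol ⟨a, h⟩ fun k => x k).submatrix (eraseEmb α a)
      (eraseEmb α a) = principalSub A (α.erase a) := by
    ext k l
    rw [Matrix.submatrix_apply, Matrix.updateCol_ne (hne l)]
    rfl
  rw [hsub, Matrix.updateCol_self, principalMinor]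
  congr 1
  rw [← Finset.sum_coe_sort (α.erase a)]
  refine Finset.sum_congr rfl fun c _ => ?_
  rw [colMinor_of_mem A c.2, Matrix.updateCol_ne (hne c)]
  congr 3
  funext k
  rw [Matrix.updateCol_self]
  rfl

theorem principalMinor_empty (A : Matrix ι ι R) : principalMinor A ∅ = 1 := by
  rw [principalMinor, hermDet, dif_neg]
  rw [Finset.univ_nonempty_iff, not_nonempty_iff]
  exact ⟨fun x => absurd x.2 (Finset.notMem_empty _)⟩

theorem rdet_principalSub_eq_colMinor (A : Matrix ι ι R) {α : Finset ι} {a : ι} (h : a ∈ α) :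
    rdet ⟨a, h⟩ (principalSub A α) = colMinor A α a fun k => A k a := by
  rw [colMinor_of_mem A h]
  congr 1
  ext k l
  by_cases hl : l = ⟨a, h⟩
  · subst hl
    rw [Matrix.updateCol_self]
    rfl
  · rw [Matrix.updateCol_ne hl]

theorem principalMinor_eq_colMinor (A : Matrix ι ι R) {α : Finset ι} (h : α.Nonempty) :
    principalMinor A α = colMinor A α (α.min' h) fun k => A k (α.min' h) := by
  have hu : (Finset.univ : Finset {x // x ∈ α}).Nonempty :=
    Finset.univ_nonempty_iff.2 h.to_subtype
  rw [principalMinor, hermDet, dif_pos hu, ← rdet_principalSub_eq_colMinor A (α.min'_mem h)]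
  congr 1
  refine le_antisymm (Finset.min'_le _ _ (Finset.mem_univ _)) ?_
  exact Finset.min'_le α _ (Finset.univ.min' hu).2

theorem rdet_eq_principalSub_univ (A : Matrix ι ι R) (j : ι) :
    rdet j A = rdet ⟨j, Finset.mem_univ j⟩ (principalSub A Finset.univ) := by
  let f : {x // x ∈ Finset.univ.erase j} ↪o ι := OrderEmbedding.subtype _
  have hf : ∀ x, x ≠ j ↔ x ∈ Set.range f := by
    intro x
    constructor
    · intro h
      exact ⟨⟨x, Finset.mem_erase.2 ⟨h, Finset.mem_univ _⟩⟩, rfl⟩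
    · rintro ⟨y, rfl⟩
      exact Finset.ne_of_mem_erase y.2
  rw [rdet_eq_sub_sum hf,
    rdet_eq_sub_sum (ne_iff_mem_range_eraseEmb Finset.univ ⟨j, Finset.mem_univ j⟩)]
  rfl

theorem hermDet_eq_principalMinor_univ (A : Matrix ι ι R) :
    hermDet A = principalMinor A Finset.univ := by
  by_cases h : (Finset.univ : Finset ι).Nonempty
  · rw [hermDet, dif_pos h, rdet_eq_principalSub_univ, rdet_principalSub_eq_colMinor,
      principalMinor_eq_colMinor A h]
  · rw [hermDet, dif_neg h, Finset.not_nonempty_iff_eq_empty.1 h, principalMinor_empty]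

theorem colMinor_congr (A : Matrix ι ι R) (α : Finset ι) (a : ι) {x y : ι → R}
    (h : ∀ k ∈ α, x k = y k) : colMinor A α a x = colMinor A α a y := by
  by_cases ha : a ∈ α
  · rw [colMinor_of_mem A ha, colMinor_of_mem A ha]
    congr 2
    funext k
    exact h _ k.2
  · rw [colMinor_of_notMem A ha, colMinor_of_notMem A ha]

theorem colMinor_add (A : Matrix ι ι R) (α : Finset ι) (a : ι) (x y : ι → R) :
    colMinor A α a (fun k => x k + y k) = colMinor A α a x + colMinor A α a y := by
  induction α using Finset.strongInduction generalizing a with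
  | H α ih =>
    by_cases h : a ∈ α
    · rw [colMinor_eq A h, colMinor_eq A h, colMinor_eq A h,
        Finset.sum_congr rfl fun c _ => by rw [ih _ (Finset.erase_ssubset h)]]
      simp only [add_mul, mul_add, Finset.sum_add_distrib]
      abel
    · simp [colMinor_of_notMem A h]

theorem colMinor_single_of_notMem (A : Matrix ι ι R) {α : Finset ι} {a b : ι} (hb : b ∉ α) :
    colMinor A α a (Pi.single b 1) = 0 := by
  induction α using Finset.strongInduction generalizing a with
  | H α ih =>
    by_cases h : a ∈ α
    · have hab : a ≠ b := fun h' => hb (h' ▸ h)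
      rw [colMinor_eq A h, Finset.sum_eq_zero fun c _ => by
        rw [ih _ (Finset.erase_ssubset h) fun h' => hb (Finset.mem_of_mem_erase h'), mul_zero]]
      simp [hab]
    · rw [colMinor_of_notMem A h]

/-- Entries of the replaced column have factors on both sides in the monomials, so only scalars
acting centrally can be pulled out. -/
theorem colMinor_smul {S : Type*} [CommRing S] [Algebra S R] (A : Matrix ι ι R) (α : Finset ι)
    (a : ι) (t : S) (x : ι → R) :
    colMinor A α a (fun k => t • x k) = t • colMinor A α a x := by
  induction α using Finset.strongInduction generalizing a with
  | H α ih =>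
    by_cases h : a ∈ α
    · rw [colMinor_eq A h, colMinor_eq A h,
        Finset.sum_congr rfl fun c _ => by rw [ih _ (Finset.erase_ssubset h)]]
      simp only [smul_sub, Finset.smul_sum, mul_smul_comm, smul_mul_assoc]
    · simp [colMinor_of_notMem A h]

end PrincipalMinors

/-! ### Expansion of the minors of A + tI in powers of t. -/

section Shift

variable {ι R S : Type*} [Fintype ι] [LinearOrder ι] [Ring R] [CommRing S] [Algebra S R]

/-- The matrix `A + t I`. -/
def shift (A : Matrix ι ι R) (t : S) : Matrix ι ι R := A + t • 1

theorem shift_apply_ne (A : Matrix ι ι R) (t : S) {a b : ι} (h : a ≠ b) :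
    shift A t a b = A a b := by
  simp [shift, Matrix.one_apply_ne h]

theorem shift_apply (A : Matrix ι ι R) (t : S) (a b : ι) :
    shift A t a b = A a b + t • (Pi.single b 1 : ι → R) a := by
  simp [shift, Matrix.one_apply, Pi.single_apply]

theorem sum_powerset_insert_of_notMem {M : Type*} [AddCommMonoid M] {s : Finset ι} {a : ι}
    (h : a ∉ s) (F : Finset ι → M) : ∑ γ ∈ (insert a s).powerset, F γ =
      ∑ γ ∈ s.powerset, F γ + ∑ γ ∈ s.powerset, F (insert a γ) :=
  Finset.sum_powerset_insert h F

/-- The statement that the minors of `A + t I` on `α` expand in powers of `t`. -/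
def ShiftExpansion (A : Matrix ι ι R) (t : S) (α : Finset ι) : Prop :=
  principalMinor (shift A t) α =
      ∑ γ ∈ α.powerset, t ^ (α.card - γ.card) • principalMinor A γ ∧
    ∀ a ∈ α, ∀ x, colMinor (shift A t) α a x =
      ∑ γ ∈ (α.erase a).powerset, t ^ (α.card - 1 - γ.card) • colMinor A (insert a γ) a x

/-- The expression u · minor − Σ v_c · (minor with column c replaced) is the common shape of
`colMinor_eq` and `rowMinor`. It is treated once, with arbitrary border data. -/
theorem ShiftExpansion.bordered {A : Matrix ι ι R} {t : S} {β : Finset ι}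
    (H : ShiftExpansion A t β) (u : R) (v x : ι → R) :
    u * principalMinor (shift A t) β - ∑ c ∈ β, v c * colMinor (shift A t) β c x =
      ∑ γ ∈ β.powerset, t ^ (β.card - γ.card) •
        (u * principalMinor A γ - ∑ c ∈ γ, v c * colMinor A γ c x) := by
  have hc : ∀ c ∈ β, v c * colMinor (shift A t) β c x =
      ∑ γ ∈ β.powerset, t ^ (β.card - γ.card) • (v c * colMinor A γ c x) := by
    intro c hc
    rw [H.2 c hc]
    conv_rhs => rw [← Finset.insert_erase hc,
      sum_powerset_insert_of_notMem (Finset.notMem_erase c _), Finset.insert_erase hc]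
    rw [Finset.mul_sum, Finset.sum_eq_zero (s := (β.erase c).powerset)
      (f := fun γ => t ^ (β.card - γ.card) • (v c * colMinor A γ c x)), zero_add]
    · refine Finset.sum_congr rfl fun γ hγ => ?_
      have : c ∉ γ := fun h => Finset.notMem_erase c _ (Finset.mem_powerset.1 hγ h)
      rw [Finset.card_insert_of_notMem this, mul_smul_comm]
      congr 2
      omega
    · intro γ hγ
      have : c ∉ γ := fun h => Finset.notMem_erase c _ (Finset.mem_powerset.1 hγ h)
      rw [colMinor_of_notMem A this, mul_zero, smul_zero]
  rw [H.1, Finset.sum_congr rfl hc, Finset.sum_comm, Finset.mul_sum, ← Finset.sum_sub_distrib]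
  refine Finset.sum_congr rfl fun γ hγ => ?_
  rw [mul_smul_comm, smul_sub, Finset.smul_sum]
  congr 1
  -- The convention that `colMinor` is 0 when its index lies outside γ lets the sum over β shrink to
  -- γ.
  refine (Finset.sum_subset (Finset.mem_powerset.1 hγ) fun c _ hcγ => ?_).symm
  rw [colMinor_of_notMem A hcγ, mul_zero, smul_zero]

/-- Removing index a leaves only off-diagonal entries of row a, which the shift does not touch. For
the unreplaced minor, column a gains t times a unit vector, whose contribution is the minor with a
removed. -/
theorem shiftExpansion (A : Matrix ι ι R) (t : S) (α : Finset ι) : ShiftExpansion A t α := by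
  induction α using Finset.strongInduction with
  | H α ih =>
    have hcol : ∀ a ∈ α, ∀ x, colMinor (shift A t) α a x =
      ∑ γ ∈ (α.erase a).powerset,
        t ^ (α.card - 1 - γ.card) • colMinor A (insert a γ) a x := by
      intro a ha x
      rw [colMinor_eq _ ha, Finset.sum_congr rfl fun c hc => by
        rw [shift_apply_ne A t (Finset.ne_of_mem_erase hc).symm],
        (ih _ (Finset.erase_ssubset ha)).bordered]
      refine Finset.sum_congr rfl fun γ hγ => ?_
      have haγ : a ∉ γ := fun h => Finset.notMem_erase a _ (Finset.mem_powerset.1 hγ h)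
      rw [colMinor_eq A (Finset.mem_insert_self a γ), Finset.erase_insert haγ,
        Finset.card_erase_of_mem ha]
    refine ⟨?_, hcol⟩
    rcases α.eq_empty_or_nonempty with rfl | hne
    · simp [principalMinor_empty]
    · rw [principalMinor_eq_colMinor _ hne]
      set a := α.min' hne with ha_def
      have ha : a ∈ α := α.min'_mem hne
      have hcard : 0 < α.card := Finset.card_pos.2 hne
      rw [hcol a ha, ← Finset.insert_erase ha,
        sum_powerset_insert_of_notMem (Finset.notMem_erase a _), Finset.insert_erase ha,
        ← Finset.sum_add_distrib]
      refine Finset.sum_congr rfl fun γ hγ => ?_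
      have haγ : a ∉ γ := fun h => Finset.notMem_erase a _ (Finset.mem_powerset.1 hγ h)
      have hle := Finset.card_le_card (Finset.mem_powerset.1 hγ)
      rw [Finset.card_erase_of_mem ha] at hle
      -- The minimum of α is also the minimum of each subset containing it. This matters because A
      -- need not be Hermitian here, so the determinant may depend on the distinguished index.
      have hmin : ∀ h : (insert a γ).Nonempty, (insert a γ).min' h = a := fun h =>
        le_antisymm (Finset.min'_le _ _ (Finset.mem_insert_self a γ))
          (Finset.min'_le _ _ (Finset.insert_subset ha
            ((Finset.mem_powerset.1 hγ).trans (Finset.erase_subset a α))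
            ((insert a γ).min'_mem h)))
      have e1 : principalMinor A (insert a γ) = colMinor A (insert a γ) a fun k => A k a := by
        rw [principalMinor_eq_colMinor A (Finset.insert_nonempty a γ), hmin]
      have e2 : colMinor A (insert a γ) a (Pi.single a 1) = principalMinor A γ := by
        rw [colMinor_eq A (Finset.mem_insert_self a γ), Finset.erase_insert haγ,
          Finset.sum_eq_zero fun c _ => by rw [colMinor_single_of_notMem A haγ, mul_zero]]
        simp
      have e3 : (fun k => shift A t k a) = fun k => A k a + t • (Pi.single a 1 : ι → R) k :=
        funext fun k => shift_apply A t k a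
      rw [e3, colMinor_add, colMinor_smul, e2, ← e1, smul_add, smul_smul, ← pow_succ,
        Finset.card_insert_of_notMem haγ, add_comm]
      congr 3 <;> omega

theorem rowMinor_shift (A : Matrix ι ι R) (t : S) {α : Finset ι} {a : ι} (ha : a ∈ α)
    (v : ι → R) : rowMinor (shift A t) α a v =
      ∑ γ ∈ (α.erase a).powerset, t ^ (α.card - 1 - γ.card) • rowMinor A (insert a γ) a v := by
  have hx : ∀ c ∈ α.erase a, colMinor (shift A t) (α.erase a) c (fun k => shift A t k a) =
      colMinor (shift A t) (α.erase a) c fun k => A k a := fun c _ =>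
    colMinor_congr _ _ _ fun k hk => shift_apply_ne A t (Finset.ne_of_mem_erase hk)
  rw [rowMinor, Finset.sum_congr rfl fun c hc => by rw [hx c hc],
    (shiftExpansion A t (α.erase a)).bordered]
  refine Finset.sum_congr rfl fun γ hγ => ?_
  have haγ : a ∉ γ := fun h => Finset.notMem_erase a _ (Finset.mem_powerset.1 hγ h)
  rw [rowMinor, Finset.erase_insert haγ, Finset.card_erase_of_mem ha]

end Shift

/-! ### Cramer's rule for positive definite quaternion matrices. -/

section PositiveDefinite

variable {ι : Type*} [Fintype ι] [LinearOrder ι]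

/-- The principal submatrix of `M` on `α` is positive definite. -/
def PosDefOn (M : Matrix ι ι ℍ[ℝ]) (α : Finset ι) : Prop :=
  ∀ y : ι → ℍ[ℝ], (∃ a ∈ α, y a ≠ 0) → 0 < (∑ a ∈ α, star (y a) * ∑ b ∈ α, M a b * y b).re

/-- The restriction of `z` to `β` solves the linear system with the principal submatrix of `M` on
`β` and the right-hand side `x`. -/
def SolvesOn (M : Matrix ι ι ℍ[ℝ]) (β : Finset ι) (z x : ι → ℍ[ℝ]) : Prop :=
  ∀ k ∈ β, ∑ c ∈ β, M k c * z c = x k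

/-- Cramer's rule for the principal submatrix of `M` on `α`, with determinant `h`. -/
structure CramerOn (M : Matrix ι ι ℍ[ℝ]) (α : Finset ι) (h : ℝ) : Prop where
  minor_eq : principalMinor M α = (h : ℍ[ℝ])
  col_eq : ∀ z x, SolvesOn M α z x → ∀ a ∈ α, colMinor M α a x = h • z a

theorem PosDefOn.mono {M : Matrix ι ι ℍ[ℝ]} {α β : Finset ι} (hM : PosDefOn M α) (h : β ⊆ α) :
    PosDefOn M β := by
  rintro y ⟨a, ha, hy⟩
  have := hM (fun k => if k ∈ β then y k else 0) ⟨a, h ha, by simpa [ha] using hy⟩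
  have e1 : ∀ a, ∑ b ∈ α, M a b * (if b ∈ β then y b else 0) = ∑ b ∈ β, M a b * y b := by
    intro a
    rw [← Finset.sum_subset h (f := fun b => M a b * (if b ∈ β then y b else 0))]
    · exact Finset.sum_congr rfl fun b hb => by simp [hb]
    · intro b _ hb
      simp [hb]
  simp only [e1] at this
  rwa [← Finset.sum_subset h
    (f := fun a => star (if a ∈ β then y a else 0) * ∑ b ∈ β, M a b * y b),
    Finset.sum_congr rfl fun b hb => by rw [if_pos hb]] at this
  intro b _ hb
  simp [hb]

/-- Extended by the identity outside α, the system becomes an injective endomorphism of a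
finite-dimensional real space, hence a surjective one. -/
theorem PosDefOn.exists_solvesOn {M : Matrix ι ι ℍ[ℝ]} {α : Finset ι} (hM : PosDefOn M α)
    (x : ι → ℍ[ℝ]) : ∃ z, SolvesOn M α z x := by
  classical
  let L : (ι → ℍ[ℝ]) →ₗ[ℝ] (ι → ℍ[ℝ]) :=
    { toFun := fun y k => if k ∈ α then ∑ c ∈ α, M k c * y c else y k
      map_add' := fun y z => by
        ext1 k
        by_cases hk : k ∈ α <;> simp [hk, mul_add, Finset.sum_add_distrib]
      map_smul' := fun t y => by
        ext1 k
        by_cases hk : k ∈ α <;> simp [hk, Finset.smul_sum] }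
  have hinj : Function.Injective L := by
    rw [← LinearMap.ker_eq_bot, LinearMap.ker_eq_bot']
    intro y hy
    have h1 : ∀ k ∈ α, ∑ c ∈ α, M k c * y c = 0 := fun k hk => by
      have := congrFun hy k
      simpa [L, hk] using this
    ext1 k
    by_cases hk : k ∈ α
    · by_contra hne
      have := hM y ⟨k, hk, hne⟩
      rw [Finset.sum_eq_zero fun a ha => by rw [h1 a ha, mul_zero]] at this
      simp at this
    · have := congrFun hy k
      simpa [L, hk] using this
  obtain ⟨z, hz⟩ := (LinearMap.injective_iff_surjective.1 hinj) x
  exact ⟨z, fun k hk => by simpa [L, hk] using congrFun hz k⟩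

/-- Under Cramer's rule, the expansion becomes the determinant times the Schur complement u − v M⁻¹
x. -/
theorem CramerOn.bordered {M : Matrix ι ι ℍ[ℝ]} {β : Finset ι} {h : ℝ} (H : CramerOn M β h)
    {z x : ι → ℍ[ℝ]} (hz : SolvesOn M β z x) (u : ℍ[ℝ]) (v : ι → ℍ[ℝ]) :
    u * principalMinor M β - ∑ c ∈ β, v c * colMinor M β c x =
      h • (u - ∑ c ∈ β, v c * z c) := by
  rw [H.minor_eq, Quaternion.mul_coe_eq_smul, smul_sub, Finset.smul_sum]
  congr 1
  exact Finset.sum_congr rfl fun c hc => by rw [H.col_eq z x hz c hc, mul_smul_comm]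

theorem sum_eq_add_sum_erase {α : Finset ι} {a : ι} (ha : a ∈ α) (F : ι → ℍ[ℝ]) :
    ∑ c ∈ α, F c = F a + ∑ c ∈ α.erase a, F c :=
  (Finset.add_sum_erase α F ha).symm

/-- Eliminating β from a Hermitian matrix leaves a Hermitian matrix. For a = b this makes the Schur
complement real. -/
theorem SolvesOn.star_cross {M : Matrix ι ι ℍ[ℝ]} (hM : M.IsHermitian) {β : Finset ι}
    {p q : ι → ℍ[ℝ]} {a b : ι} (hp : SolvesOn M β p fun k => M k a)
    (hq : SolvesOn M β q fun k => M k b) :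
    star (M a b - ∑ c ∈ β, M a c * q c) = M b a - ∑ c ∈ β, M b c * p c := by
  have hs : ∀ a b, star (M a b) = M b a := fun a b => hM.apply b a
  rw [star_sub, hs, star_sum]
  congr 1
  have e1 : ∀ c ∈ β, star (M a c * q c) = ∑ d ∈ β, star (q c) * (M c d * p d) := by
    intro c hc
    have h := hp c hc
    simp only at h
    rw [star_mul, hs, ← h, Finset.mul_sum]
  have e2 : ∀ d ∈ β, M b d * p d = ∑ c ∈ β, star (q c) * (M c d * p d) := by
    intro d hd
    have h := hq d hd
    simp only at h
    rw [← hs, ← h, star_sum, Finset.sum_mul]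
    exact Finset.sum_congr rfl fun c _ => by rw [star_mul, hs, mul_assoc]
  rw [Finset.sum_congr rfl e1, Finset.sum_congr rfl e2, Finset.sum_comm]

theorem exists_coe_of_star_eq {x : ℍ[ℝ]} (h : star x = x) : x = ((x.re : ℝ) : ℍ[ℝ]) :=
  Quaternion.star_eq_self.1 h

/-- The Schur complement of a positive definite matrix is a positive real number. -/
theorem PosDefOn.schur {M : Matrix ι ι ℍ[ℝ]} (hH : M.IsHermitian) {α : Finset ι}
    (hM : PosDefOn M α) {a : ι} (ha : a ∈ α) {z : ι → ℍ[ℝ]}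
    (hz : SolvesOn M (α.erase a) z fun k => M k a) :
    ∃ s : ℝ, 0 < s ∧ M a a - ∑ c ∈ α.erase a, M a c * z c = (s : ℍ[ℝ]) := by
  refine ⟨(M a a - ∑ c ∈ α.erase a, M a c * z c).re, ?_,
    exists_coe_of_star_eq (hz.star_cross hH hz)⟩
  have h1 : ∀ k, ∑ b ∈ α, M k b * (if b = a then 1 else -z b) =
      M k a - ∑ c ∈ α.erase a, M k c * z c := by
    intro k
    rw [sum_eq_add_sum_erase ha, if_pos rfl, mul_one, sub_eq_add_neg, ← Finset.sum_neg_distrib]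
    congr 1
    exact Finset.sum_congr rfl fun c hc => by rw [if_neg (Finset.ne_of_mem_erase hc), mul_neg]
  -- On the test vector with entry 1 at a and −z elsewhere, M vanishes off a, and the quadratic form
  -- equals the Schur complement.
  have := hM (fun b => if b = a then 1 else -z b) ⟨a, ha, by simp⟩
  simp only [h1] at this
  have h2 : ∑ k ∈ α.erase a, star (if k = a then (1 : ℍ[ℝ]) else -z k) *
      (M k a - ∑ c ∈ α.erase a, M k c * z c) = 0 :=
    Finset.sum_eq_zero fun k hk => by rw [hz k hk, sub_self, mul_zero]
  rwa [sum_eq_add_sum_erase ha, h2, add_zero, if_pos rfl, star_one, one_mul] at this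

/-- Elimination of two rows and columns. -/
theorem CramerOn.colMinor_insert_insert {M : Matrix ι ι ℍ[ℝ]} {V : Finset ι} {h : ℝ}
    (H : CramerOn M V h) {a b : ι} (hab : a ≠ b) (ha : a ∉ V) (hb : b ∉ V) {p q : ι → ℍ[ℝ]}
    (hp : SolvesOn M V p fun k => M k a) (hq : SolvesOn M V q fun k => M k b) {s t : ℝ}
    (hs : M a a - ∑ c ∈ V, M a c * p c = s) (ht : M b b - ∑ c ∈ V, M b c * q c = t)
    (ht0 : t ≠ 0) {g : ℝ} (H' : CramerOn M (insert b V) g) :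
    colMinor M (insert a (insert b V)) a (fun k => M k a) = h • (t • (s : ℍ[ℝ]) -
      (M a b - ∑ c ∈ V, M a c * q c) * (M b a - ∑ c ∈ V, M b c * p c)) := by
  set w := M b a - ∑ c ∈ V, M b c * p c with hw
  have hne : ∀ c ∈ V, c ≠ b := fun c hc h' => hb (h' ▸ hc)
  have hsum : ∀ k, ∑ c ∈ V, M k c * (if c = b then t⁻¹ • w else p c - q c * (t⁻¹ • w)) =
      ∑ c ∈ V, M k c * p c - (∑ c ∈ V, M k c * q c) * (t⁻¹ • w) := by
    intro k
    rw [Finset.sum_mul, ← Finset.sum_sub_distrib]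
    exact Finset.sum_congr rfl fun c hc => by rw [if_neg (hne c hc), mul_sub, mul_assoc]
  have hz : SolvesOn M (insert b V) (fun c => if c = b then t⁻¹ • w else p c - q c * (t⁻¹ • w))
      fun k => M k a := by
    intro k hk
    simp only
    rw [Finset.sum_insert hb, hsum, if_pos rfl]
    rcases Finset.mem_insert.1 hk with rfl | hk
    · have : M k k = t + ∑ c ∈ V, M k c * q c := by rw [← ht]; abel
      rw [this, add_mul, Quaternion.coe_mul_eq_smul, smul_smul, mul_inv_cancel₀ ht0, one_smul, hw]
      abel
    · rw [hp k hk, hq k hk]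
      abel
  -- Testing Cramer's rule on column b, whose solution is the unit vector at b, identifies the
  -- larger determinant as h times the Schur complement at b.
  have hg : (g : ℍ[ℝ]) = h • (t : ℍ[ℝ]) := by
    have h1 := H'.col_eq (Pi.single b 1) (fun k => M k b) (fun k _ => by
      rw [Finset.sum_insert hb, Finset.sum_eq_zero fun c hc => by
        rw [Pi.single_eq_of_ne (hne c hc), mul_zero]]
      simp) b (Finset.mem_insert_self b V)
    rw [colMinor_eq M (Finset.mem_insert_self b V), Finset.erase_insert hb,
      H.bordered hq, ht, Pi.single_eq_same] at h1
    rw [h1, ← Quaternion.coe_mul_eq_smul, mul_one]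
  have hai : a ∉ insert b V := by simp [hab, ha]
  rw [colMinor_eq M (Finset.mem_insert_self a _), Finset.erase_insert hai, H'.bordered hz,
    Finset.sum_insert hb, hsum, if_pos rfl, ← Quaternion.coe_mul_eq_smul, hg, smul_mul_assoc,
    Quaternion.coe_mul_eq_smul, ← hs]
  congr 1
  have e : ∀ x : ℍ[ℝ], x * (t⁻¹ • w) = t⁻¹ • (x * w) := fun x => mul_smul_comm _ _ _
  rw [e, e, sub_mul, smul_sub, smul_sub, smul_add, smul_sub, smul_smul, smul_smul,
    mul_inv_cancel₀ ht0, one_smul, one_smul]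
  abel

/-- Moving the a-th unknown to the other indices, y + z y_a solves the system without a, and what is
left in row a is the Schur complement s times y_a. -/
theorem CramerOn.colMinor_solvesOn {M : Matrix ι ι ℍ[ℝ]} {α : Finset ι} {a : ι} (ha : a ∈ α)
    {h s : ℝ} (H : CramerOn M (α.erase a) h) {z : ι → ℍ[ℝ]}
    (hz : SolvesOn M (α.erase a) z fun k => M k a)
    (hs : M a a - ∑ c ∈ α.erase a, M a c * z c = (s : ℍ[ℝ])) {y x : ι → ℍ[ℝ]}
    (hy : SolvesOn M α y x) : colMinor M α a x = (h * s) • y a := by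
  have hy' : SolvesOn M (α.erase a) (fun c => y c + z c * y a) x := by
    intro k hk
    have h1 := hy k (Finset.mem_of_mem_erase hk)
    have h2 := hz k hk
    simp only at h2
    rw [sum_eq_add_sum_erase ha, ← h2, Finset.sum_mul, ← Finset.sum_add_distrib] at h1
    rw [← h1]
    exact Finset.sum_congr rfl fun c _ => by rw [mul_add, mul_assoc, add_comm]
  rw [colMinor_eq M ha, H.bordered hy', mul_smul, ← hy a ha, sum_eq_add_sum_erase ha]
  congr 1
  have : M a a = s + ∑ c ∈ α.erase a, M a c * z c := by rw [← hs]; abel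
  rw [this, add_mul, Quaternion.coe_mul_eq_smul]
  simp only [mul_add, Finset.sum_add_distrib, Finset.sum_mul, mul_assoc]
  abel

/-- Cramer's rule for positive definite quaternion matrices. -/
theorem PosDefOn.exists_cramerOn {M : Matrix ι ι ℍ[ℝ]} (hH : M.IsHermitian) {α : Finset ι}
    (hM : PosDefOn M α) : ∃ h : ℝ, 0 < h ∧ CramerOn M α h := by
  induction α using Finset.strongInduction with
  | H α ih =>
    -- Cramer's rule at each index a, with a constant that may still depend on a.
    have key : ∀ a ∈ α, ∃ t : ℝ, 0 < t ∧ colMinor M α a (fun k => M k a) = t ∧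
        ∀ z x, SolvesOn M α z x → colMinor M α a x = t • z a := by
      intro a ha
      obtain ⟨h, h0, H⟩ := ih _ (Finset.erase_ssubset ha) (hM.mono (Finset.erase_subset a α))
      obtain ⟨z, hz⟩ := (hM.mono (Finset.erase_subset a α)).exists_solvesOn fun k => M k a
      obtain ⟨s, s0, hs⟩ := hM.schur hH ha hz
      refine ⟨h * s, mul_pos h0 s0, ?_, fun y x hy => H.colMinor_solvesOn ha hz hs hy⟩
      rw [colMinor_eq M ha, H.bordered hz, hs, ← Quaternion.coe_mul_eq_smul, Quaternion.coe_mul]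
    rcases α.eq_empty_or_nonempty with rfl | hne
    · exact ⟨1, one_pos, by rw [principalMinor_empty]; rfl,
        fun _ _ _ a ha => absurd ha (Finset.notMem_empty a)⟩
    obtain ⟨t, t0, ht, -⟩ := key _ (α.min'_mem hne)
    refine ⟨t, t0, by rw [principalMinor_eq_colMinor M hne, ht], fun z x hz a ha => ?_⟩
    obtain ⟨u, -, hu, hu'⟩ := key a ha
    -- The constants at a and b are compared by eliminating all other indices. Both become h(rs −
    -- |w|²), since the off-diagonal entries of the remaining 2 × 2 Hermitian matrix are conjugate.
    have htu : t = u := by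
      rw [← Quaternion.coe_inj, ← ht, ← hu]
      by_cases hab : a = α.min' hne
      · rw [← hab]
      set b := α.min' hne
      have hb : b ∈ α := α.min'_mem hne
      set V := (α.erase a).erase b with hV
      have hbV : b ∉ V := Finset.notMem_erase b _
      have haV : a ∉ V := fun h' => Finset.notMem_erase a α (Finset.mem_of_mem_erase h')
      have hb' : b ∈ α.erase a := Finset.mem_erase.2 ⟨Ne.symm hab, hb⟩
      have e1 : insert b V = α.erase a := Finset.insert_erase hb'
      have e2 : insert a (insert b V) = α := by rw [e1, Finset.insert_erase ha]
      have e3 : insert a V = α.erase b := by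
        rw [← e2, Finset.insert_comm, Finset.erase_insert]
        simp [Ne.symm hab, hbV]
      have hVα : V ⊂ α :=
        (Finset.erase_subset b _).trans_ssubset (Finset.erase_ssubset ha)
      obtain ⟨h, h0, H⟩ := ih V hVα (hM.mono hVα.subset)
      obtain ⟨g, g0, G⟩ := ih _ (Finset.erase_ssubset ha) (hM.mono (Finset.erase_subset a α))
      obtain ⟨g', g0', G'⟩ := ih _ (Finset.erase_ssubset hb) (hM.mono (Finset.erase_subset b α))
      rw [← e1] at G
      rw [← e3] at G'
      obtain ⟨p, hp⟩ := (hM.mono hVα.subset).exists_solvesOn fun k => M k a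
      obtain ⟨q, hq⟩ := (hM.mono hVα.subset).exists_solvesOn fun k => M k b
      have ha3 : (insert a V).erase a = V := Finset.erase_insert haV
      have hb3 : (insert b V).erase b = V := Finset.erase_insert hbV
      obtain ⟨s, s0, hs⟩ := (hM.mono (e3 ▸ Finset.erase_subset b α : insert a V ⊆ α)).schur hH
        (Finset.mem_insert_self a V) (z := p) (by rw [ha3]; exact hp)
      obtain ⟨r, r0, hr⟩ := (hM.mono (e1 ▸ Finset.erase_subset a α : insert b V ⊆ α)).schur hH
        (Finset.mem_insert_self b V) (z := q) (by rw [hb3]; exact hq)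
      rw [ha3] at hs
      rw [hb3] at hr
      have k1 := H.colMinor_insert_insert hab haV hbV hp hq hs hr r0.ne' G
      have k2 := H.colMinor_insert_insert (Ne.symm hab) hbV haV hq hp hr hs s0.ne' G'
      rw [Finset.insert_comm] at k2
      rw [e2] at k1 k2
      rw [k1, k2, ← hp.star_cross hH hq, Quaternion.star_mul_self, Quaternion.self_mul_star,
        ← Quaternion.coe_mul_eq_smul s, ← Quaternion.coe_mul_eq_smul r,
        Quaternion.coe_commutes]
    rw [hu' z x hz, htu]

/-- Cramer's rule for left systems `y M = v`. -/
theorem PosDefOn.rowMinor_eq {M : Matrix ι ι ℍ[ℝ]} (hH : M.IsHermitian) {α : Finset ι}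
    (hM : PosDefOn M α) {h : ℝ} (H : CramerOn M α h) {i : ι} (hi : i ∈ α) (y : ι → ℍ[ℝ]) :
    rowMinor M α i (fun c => ∑ k ∈ α, y k * M k c) = h • y i := by
  have hm := hM.mono (Finset.erase_subset i α)
  obtain ⟨g, g0, G⟩ := hm.exists_cramerOn hH
  obtain ⟨z, hz⟩ := hm.exists_solvesOn fun k => M k i
  obtain ⟨s, s0, hs⟩ := hM.schur hH hi hz
  have hsol : SolvesOn M α (Pi.single i 1) fun k => M k i := fun k _ => by
    simp [Pi.single_apply, hi]
  have e1 := H.col_eq _ _ hsol i hi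
  rw [colMinor_eq M hi, G.bordered hz, hs, Pi.single_eq_same] at e1
  have hgs : h = g * s := by
    rw [← Quaternion.coe_inj, Quaternion.coe_mul, Quaternion.coe_mul_eq_smul, e1,
      ← Quaternion.coe_mul_eq_smul, mul_one]
  rw [rowMinor, G.bordered hz, hgs, mul_smul]
  congr 1
  simp only [Finset.sum_mul]
  have h0 : ∑ k ∈ α.erase i, (y k * M k i - ∑ c ∈ α.erase i, y k * M k c * z c) = 0 := by
    refine Finset.sum_eq_zero fun k hk => ?_
    have h2 := hz k hk
    simp only at h2
    rw [← h2, Finset.mul_sum, sub_eq_zero]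
    simp only [mul_assoc]
  rw [Finset.sum_comm, ← Finset.sum_sub_distrib, sum_eq_add_sum_erase hi, h0, add_zero,
    ← Quaternion.mul_coe_eq_smul, ← hs, mul_sub, Finset.mul_sum]
  simp only [mul_assoc]

end PositiveDefinite

/-! ### Sums of minors of fixed order as coefficients in t. -/

section Sums

variable {ι R : Type*} [Fintype ι] [LinearOrder ι] [Ring R]

theorem minorSum_eq_sum (s : ℕ) (A : Matrix ι ι R) :
    minorSum s A = ∑ γ ∈ Finset.univ.powersetCard s, principalMinor A γ := by
  rw [minorSum, Finset.sum_subtype (p := fun γ : Finset ι => γ.card = s)]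
  · rfl
  · intro γ
    simp

theorem rdetSum_eq_sum (s : ℕ) (j : ι) (A : Matrix ι ι R) : rdetSum s j A =
    ∑ γ ∈ Finset.univ.powersetCard s, if j ∈ γ then rowMinor A γ j (A j) else 0 := by
  rw [rdetSum, ← Finset.sum_filter,
    Finset.sum_subtype (p := fun γ : Finset ι => γ.card = s ∧ j ∈ γ)]
  · exact Finset.sum_congr rfl fun γ _ => rdet_principalSub A γ.2.2
  · intro γ
    simp

theorem rdetSum_updateRow (s : ℕ) (j : ι) (A : Matrix ι ι R) (v : ι → R) :
    rdetSum s j (A.updateRow j v) =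
      ∑ γ ∈ Finset.univ.powersetCard s, if j ∈ γ then rowMinor A γ j v else 0 := by
  rw [rdetSum_eq_sum]
  refine Finset.sum_congr rfl fun γ _ => ?_
  rw [Matrix.updateRow_self, rowMinor_congr γ j fun k l hk => by rw [Matrix.updateRow_ne hk]]

theorem rdetSum_card (j : ι) (A : Matrix ι ι R) : rdetSum (Fintype.card ι) j A = rdet j A := by
  rw [rdetSum_eq_sum, rdet_eq_principalSub_univ, rdet_principalSub, ← Finset.card_univ,
    Finset.powersetCard_self]
  simp

theorem minorSum_card (A : Matrix ι ι R) : minorSum (Fintype.card ι) A = hermDet A := by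
  rw [minorSum_eq_sum, hermDet_eq_principalMinor_univ, ← Finset.card_univ,
    Finset.powersetCard_self, Finset.sum_singleton]

theorem cdetSum_eq_star_rdetSum [StarRing R] (s : ℕ) (i : ι) (A : Matrix ι ι R) :
    cdetSum s i A = star (rdetSum s i Aᴴ) := by
  rw [cdetSum, rdetSum, star_sum]
  refine Finset.sum_congr rfl fun γ _ => ?_
  rw [cdet_eq_star_rdet]
  rfl

theorem cdetSum_card [StarRing R] (i : ι) (A : Matrix ι ι R) :
    cdetSum (Fintype.card ι) i A = cdet i A := by
  rw [cdetSum_eq_star_rdetSum, rdetSum_card, cdet_eq_star_rdet]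

/-- Each monomial begins with the entry of the replaced row, so the dependence on v is left linear
and a matrix of cofactors makes sense. -/
theorem rowMinor_eq_sum (A : Matrix ι ι R) (α : Finset ι) (j : ι) (v : ι → R) :
    rowMinor A α j v = ∑ k, v k * rowMinor A α j (Pi.single k 1) := by
  simp only [rowMinor, mul_sub, Finset.mul_sum, Finset.sum_sub_distrib]
  rw [Finset.sum_comm]
  congr 1
  · rw [Finset.sum_eq_single j]
    · simp
    · intro k _ hk
      simp [hk.symm]
    · simp
  · refine Finset.sum_congr rfl fun c _ => ?_
    rw [Finset.sum_eq_single c]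
    · simp
    · intro k _ hk
      simp [hk.symm]
    · simp

/-- The matrix of the linear map that sends a row `v` to the row with the entries
`rdetSum s j (A.updateRow j v)`. -/
def cofactorMatrix (s : ℕ) (A : Matrix ι ι R) : Matrix ι ι R :=
  Matrix.of fun k j => rdetSum s j (A.updateRow j (Pi.single k 1))

theorem rdetSum_updateRow_eq_vecMul (s : ℕ) (j : ι) (A : Matrix ι ι R) (v : ι → R) :
    rdetSum s j (A.updateRow j v) = ∑ k, v k * cofactorMatrix s A k j := by
  simp only [cofactorMatrix, Matrix.of_apply, rdetSum_updateRow, Finset.mul_sum]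
  rw [Finset.sum_comm]
  refine Finset.sum_congr rfl fun γ _ => ?_
  split_ifs
  · exact rowMinor_eq_sum A γ j v
  · simp

theorem cofactorMatrix_zero (A : Matrix ι ι R) : cofactorMatrix 0 A = 0 := by
  ext k j
  simp [cofactorMatrix, rdetSum_eq_sum]

theorem cofactorMatrix_of_card_lt (A : Matrix ι ι R) {s : ℕ} (h : Fintype.card ι < s) :
    cofactorMatrix s A = 0 := by
  ext k j
  rw [cofactorMatrix, Matrix.of_apply, rdetSum_eq_sum, Finset.powersetCard_eq_empty.2 h]
  rfl

variable {S : Type*} [CommRing S] [Algebra S R]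

theorem principalMinor_shift_univ (A : Matrix ι ι R) (t : S) :
    principalMinor (shift A t) Finset.univ = ∑ s ∈ Finset.range (Fintype.card ι + 1),
      t ^ (Fintype.card ι - s) • minorSum s A := by
  rw [(shiftExpansion A t Finset.univ).1, Finset.sum_powerset, Finset.card_univ]
  refine Finset.sum_congr rfl fun s _ => ?_
  rw [minorSum_eq_sum, Finset.smul_sum]
  refine Finset.sum_congr rfl fun γ hγ => ?_
  rw [(Finset.mem_powersetCard.1 hγ).2]

theorem rowMinor_shift_univ (A : Matrix ι ι R) (t : S) (j : ι) (v : ι → R) :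
    rowMinor (shift A t) Finset.univ j v = ∑ s ∈ Finset.range (Fintype.card ι + 1),
      t ^ (Fintype.card ι - s) • rdetSum s j (A.updateRow j v) := by
  have h : rowMinor (shift A t) Finset.univ j v = ∑ γ ∈ (Finset.univ : Finset ι).powerset,
      t ^ (Fintype.card ι - γ.card) • if j ∈ γ then rowMinor A γ j v else 0 := by
    rw [← Finset.insert_erase (Finset.mem_univ j),
      sum_powerset_insert_of_notMem (Finset.notMem_erase j _),
      Finset.insert_erase (Finset.mem_univ j), rowMinor_shift A t (Finset.mem_univ j)]
    have hj : ∀ γ ∈ (Finset.univ.erase j).powerset, j ∉ γ := fun γ hγ h =>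
      Finset.notMem_erase j _ (Finset.mem_powerset.1 hγ h)
    rw [Finset.sum_eq_zero (s := (Finset.univ.erase j).powerset)
      (f := fun γ => t ^ (Fintype.card ι - γ.card) • if j ∈ γ then rowMinor A γ j v else 0),
      zero_add]
    · refine Finset.sum_congr rfl fun γ hγ => ?_
      rw [if_pos (Finset.mem_insert_self j γ), Finset.card_insert_of_notMem (hj γ hγ),
        Finset.card_univ, Nat.sub_sub, add_comm 1]
    · intro γ hγ
      rw [if_neg (hj γ hγ), smul_zero]
  rw [h, Finset.sum_powerset, Finset.card_univ]
  refine Finset.sum_congr rfl fun s _ => ?_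
  rw [rdetSum_updateRow, Finset.smul_sum]
  refine Finset.sum_congr rfl fun γ hγ => ?_
  rw [(Finset.mem_powersetCard.1 hγ).2]

end Sums

/-! ### Passage to semidefinite matrices and the recursion for cofactor matrices. -/

section PositiveSemidefinite

variable {ι : Type*} [Fintype ι] [LinearOrder ι]

/-- Each real functional turns the expression into a real polynomial vanishing on (0, ∞), so all its
coefficients are zero. -/
theorem eq_zero_of_forall_sum_pow_smul_eq_zero {V : Type*} [AddCommGroup V] [Module ℝ V] {n : ℕ}
    {g : ℕ → V} (h : ∀ t : ℝ, 0 < t → ∑ s ∈ Finset.range (n + 1), t ^ (n - s) • g s = 0) {s : ℕ}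
    (hs : s ≤ n) : g s = 0 := by
  rw [← Module.forall_dual_apply_eq_zero_iff ℝ]
  intro φ
  let P : Polynomial ℝ :=
    ∑ k ∈ Finset.range (n + 1), Polynomial.monomial (n - k) (φ (g k))
  have hP : P = 0 := by
    refine Polynomial.eq_zero_of_infinite_isRoot P ((Set.Ioi_infinite (0 : ℝ)).mono fun t ht => ?_)
    have := congrArg φ (h t ht)
    rw [map_sum, map_zero] at this
    rw [Set.mem_ofPred_eq, Polynomial.IsRoot, Polynomial.eval_finsetSum, ← this]
    refine Finset.sum_congr rfl fun k _ => ?_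
    rw [Polynomial.eval_monomial, map_smul, smul_eq_mul, mul_comm]
  have hc := congrArg (fun Q => Polynomial.coeff Q (n - s)) hP
  simp only [P, Polynomial.finsetSum_coeff, Polynomial.coeff_monomial,
    Polynomial.coeff_zero] at hc
  rw [Finset.sum_eq_single s] at hc
  · simpa using hc
  · intro k hk hks
    rw [if_neg]
    have := Finset.mem_range.1 hk
    omega
  · intro h
    exact absurd (Finset.mem_range.2 (by omega)) h

theorem quaternion_coe_sum {κ : Type*} (s : Finset κ) (f : κ → ℝ) :
    ((∑ i ∈ s, f i : ℝ) : ℍ[ℝ]) = ∑ i ∈ s, (f i : ℍ[ℝ]) :=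
  map_sum (algebraMap ℝ ℍ[ℝ]) f s

theorem isHermitian_smul_one (t : ℝ) : (t • (1 : Matrix ι ι ℍ[ℝ])).IsHermitian := by
  ext1 a b
  rw [Matrix.conjTranspose_apply, Matrix.smul_apply, Quaternion.star_smul, Matrix.smul_apply]
  simp only [Matrix.one_apply, eq_comm]
  split_ifs <;> simp

/-- `M` is Hermitian and positive semidefinite, in the form that all `M + t I` with `t > 0` are
positive definite. -/
structure PosSemidefShift (M : Matrix ι ι ℍ[ℝ]) : Prop where
  herm : M.IsHermitian
  posDef : ∀ t : ℝ, 0 < t → PosDefOn (shift M t) Finset.univ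

theorem isHermitian_shift {M : Matrix ι ι ℍ[ℝ]} (hM : M.IsHermitian) (t : ℝ) :
    (shift M t).IsHermitian :=
  hM.add (isHermitian_smul_one t)

theorem tendsto_principalMinor_shift (M : Matrix ι ι ℍ[ℝ]) (α : Finset ι) :
    Filter.Tendsto (fun t : ℝ => principalMinor (shift M t) α) (nhdsWithin 0 (Set.Ioi 0))
      (nhds (principalMinor M α)) := by
  have h : Continuous fun t : ℝ => principalMinor (shift M t) α := by
    simp only [(shiftExpansion M _ α).1]
    fun_prop
  have := h.tendsto 0
  have h0 : shift M (0 : ℝ) = M := by simp [shift]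
  rw [h0] at this
  exact this.mono_left nhdsWithin_le_nhds

theorem tendsto_smul_colMinor_shift (M : Matrix ι ι ℍ[ℝ]) {α : Finset ι} {a : ι} (ha : a ∈ α)
    (x : ι → ℍ[ℝ]) : Filter.Tendsto (fun t : ℝ => t • colMinor (shift M t) α a x)
      (nhdsWithin 0 (Set.Ioi 0)) (nhds 0) := by
  have h : Continuous fun t : ℝ => t • colMinor (shift M t) α a x := by
    simp only [(shiftExpansion M _ α).2 a ha]
    fun_prop
  have := h.tendsto 0
  rw [zero_smul] at this
  exact this.mono_left nhdsWithin_le_nhds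

theorem PosSemidefShift.exists_principalMinor_eq {M : Matrix ι ι ℍ[ℝ]} (hM : PosSemidefShift M)
    (α : Finset ι) : ∃ h : ℝ, 0 ≤ h ∧ principalMinor M α = h := by
  have hlim := tendsto_principalMinor_shift M α
  have hev : ∀ᶠ t : ℝ in nhdsWithin 0 (Set.Ioi 0), 0 ≤ (principalMinor (shift M t) α).re ∧
      star (principalMinor (shift M t) α) = principalMinor (shift M t) α := by
    filter_upwards [self_mem_nhdsWithin] with t ht
    obtain ⟨h, h0, H⟩ := ((hM.posDef t ht).mono (Finset.subset_univ α)).exists_cramerOn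
      (isHermitian_shift hM.herm t)
    rw [H.minor_eq]
    exact ⟨h0.le, Quaternion.star_coe h⟩
  refine ⟨(principalMinor M α).re, ?_, exists_coe_of_star_eq ?_⟩
  · exact ge_of_tendsto ((Quaternion.continuous_re.tendsto _).comp hlim) (hev.mono fun _ h => h.1)
  · exact tendsto_nhds_unique (hlim.star.congr' (hev.mono fun _ h => h.2)) hlim

/-- A null vector w satisfies (M + tI)w = tw on α, so Cramer's rule reads t · colMinor(w) = minor ·
w_a. As t → 0 the left side disappears while w_a ≠ 0. -/
theorem PosSemidefShift.principalMinor_eq_zero {M : Matrix ι ι ℍ[ℝ]} (hM : PosSemidefShift M)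
    {α : Finset ι} {w : ι → ℍ[ℝ]} (hw : SolvesOn M α w 0) {a : ι} (ha : a ∈ α) (hwa : w a ≠ 0) :
    principalMinor M α = 0 := by
  have hev : ∀ᶠ t : ℝ in nhdsWithin 0 (Set.Ioi 0),
      t • colMinor (shift M t) α a w = principalMinor (shift M t) α * w a := by
    filter_upwards [self_mem_nhdsWithin] with t ht
    obtain ⟨h, h0, H⟩ := ((hM.posDef t ht).mono (Finset.subset_univ α)).exists_cramerOn
      (isHermitian_shift hM.herm t)
    rw [← colMinor_smul, H.minor_eq, Quaternion.coe_mul_eq_smul]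
    refine H.col_eq _ _ (fun k hk => ?_) a ha
    simp only [shift_apply, add_mul, Finset.sum_add_distrib]
    rw [hw k hk, Pi.zero_apply, zero_add, Finset.sum_eq_single k]
    · simp
    · intro c _ hc
      simp [Pi.single_eq_of_ne hc.symm]
    · exact fun h => absurd hk h
  have h1 := (tendsto_smul_colMinor_shift M ha w).congr' hev
  have h2 := (tendsto_principalMinor_shift M α).mul_const (w a)
  exact (mul_eq_zero.1 (tendsto_nhds_unique h2 h1)).resolve_right hwa

/-- All principal minors are nonnegative reals, so a nonzero one cannot be cancelled in the sum. -/
theorem PosSemidefShift.exists_minorSum_eq {M : Matrix ι ι ℍ[ℝ]} (hM : PosSemidefShift M)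
    (s : ℕ) : ∃ e : ℝ, minorSum s M = e ∧
      ((∃ γ : Finset ι, γ.card = s ∧ principalMinor M γ ≠ 0) → e ≠ 0) := by
  choose h h0 H using hM.exists_principalMinor_eq
  refine ⟨∑ γ ∈ Finset.univ.powersetCard s, h γ, ?_, ?_⟩
  · rw [minorSum_eq_sum, quaternion_coe_sum]
    exact Finset.sum_congr rfl fun γ _ => H γ
  · rintro ⟨γ, hγ, hne⟩ he
    rw [Finset.sum_eq_zero_iff_of_nonneg fun γ _ => h0 γ] at he
    apply hne
    rw [H, he γ (Finset.mem_powersetCard.2 ⟨Finset.subset_univ γ, hγ⟩), Quaternion.coe_zero]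

/-- The recursion for the matrices of cofactors (Faddeev and LeVerrier). -/
theorem PosSemidefShift.mul_cofactorMatrix_add {M : Matrix ι ι ℍ[ℝ]} (hM : PosSemidefShift M)
    {s : ℕ} (hs : s ≤ Fintype.card ι) {e : ℝ} (he : minorSum s M = e) :
    M * cofactorMatrix s M + cofactorMatrix (s + 1) M = e • 1 := by
  set n := Fintype.card ι with hn
  choose h hh using fun s => (hM.exists_minorSum_eq s)
  have hse : e = h s := by rw [← Quaternion.coe_inj, ← he, (hh s).1]
  rw [hse, ← sub_eq_zero]
  refine eq_zero_of_forall_sum_pow_smul_eq_zero (n := n) (g := fun s =>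
    M * cofactorMatrix s M + cofactorMatrix (s + 1) M - h s • 1) (fun t ht => ?_) hs
  obtain ⟨d, -, H⟩ := (hM.posDef t ht).exists_cramerOn (isHermitian_shift hM.herm t)
  have hd : d = ∑ s ∈ Finset.range (n + 1), t ^ (n - s) * h s := by
    rw [← Quaternion.coe_inj, ← H.minor_eq, principalMinor_shift_univ, quaternion_coe_sum]
    refine Finset.sum_congr rfl fun s _ => ?_
    rw [(hh s).1, Quaternion.coe_mul, Quaternion.coe_mul_eq_smul]
  -- Cramer's rule for left systems, applied to y = e_k, says row by row that M + tI times its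
  -- cofactor matrix is d I.
  have hmul : shift M t * ∑ s ∈ Finset.range (n + 1), t ^ (n - s) • cofactorMatrix s M =
      d • 1 := by
    ext1 k j
    have h1 := (hM.posDef t ht).rowMinor_eq (isHermitian_shift hM.herm t) H (Finset.mem_univ j)
      (Pi.single k 1)
    rw [rowMinor_shift_univ] at h1
    simp only [rdetSum_updateRow_eq_vecMul] at h1
    have h2 : (d • (1 : Matrix ι ι ℍ[ℝ])) k j = d • (Pi.single k 1 : ι → ℍ[ℝ]) j := by
      rw [Matrix.smul_apply, Matrix.one_apply, Pi.single_apply]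
      simp only [eq_comm]
    rw [h2, ← h1, Finset.mul_sum, Matrix.sum_apply]
    refine Finset.sum_congr rfl fun s _ => ?_
    rw [Matrix.mul_smul, Matrix.smul_apply, Matrix.mul_apply]
    congr 1
    refine Finset.sum_congr rfl fun l _ => ?_
    rw [Finset.sum_eq_single k]
    · simp
    · intro b _ hb
      simp [Pi.single_eq_of_ne hb]
    · simp
  -- Reindexing loses nothing at either end, because the cofactor matrices of orders 0 and n + 1
  -- vanish.
  have hshift : ∑ s ∈ Finset.range (n + 1), t ^ (n - s) • cofactorMatrix (s + 1) M =
      t • ∑ s ∈ Finset.range (n + 1), t ^ (n - s) • cofactorMatrix s M := by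
    rw [Finset.sum_range_succ, cofactorMatrix_of_card_lt M (by omega), smul_zero, add_zero,
      Finset.sum_range_succ', cofactorMatrix_zero, smul_zero, add_zero, Finset.smul_sum]
    refine Finset.sum_congr rfl fun s hs => ?_
    rw [smul_smul, ← pow_succ']
    congr 2
    have := Finset.mem_range.1 hs
    omega
  simp only [smul_sub, smul_add, Finset.sum_sub_distrib, Finset.sum_add_distrib]
  rw [hshift, sub_eq_zero]
  simp only [smul_smul]
  rw [← Finset.sum_smul, ← hd, ← hmul, shift, add_mul, Finset.mul_sum]
  simp only [Matrix.mul_smul, Matrix.smul_mul, one_mul]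

/-- By the recursion C_{s+1} = e_s I − M C_s with e_s real, so every C_s is a real polynomial in M.
-/
theorem PosSemidefShift.cofactorMatrix_herm_comm {M : Matrix ι ι ℍ[ℝ]} (hM : PosSemidefShift M)
    (s : ℕ) : (cofactorMatrix s M).IsHermitian ∧ Commute M (cofactorMatrix s M) := by
  induction s with
  | zero =>
    rw [cofactorMatrix_zero]
    exact ⟨Matrix.isHermitian_zero, Commute.zero_right M⟩
  | succ s ih =>
    by_cases hs : s ≤ Fintype.card ι
    · obtain ⟨e, he, -⟩ := hM.exists_minorSum_eq s
      have h := hM.mul_cofactorMatrix_add hs he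
      rw [← eq_sub_iff_add_eq'] at h
      rw [h]
      constructor
      · refine Matrix.IsHermitian.sub ?_ ?_
        · exact isHermitian_smul_one e
        · rw [Matrix.IsHermitian, Matrix.conjTranspose_mul, ih.1, hM.herm]
          exact ih.2.symm
      · exact ((Commute.one_right M).smul_right e).sub_right ((Commute.refl M).mul_right ih.2)
    · rw [cofactorMatrix_of_card_lt M (by omega)]
      exact ⟨Matrix.isHermitian_zero, Commute.zero_right M⟩

theorem eq_zero_of_conjTranspose_mul_self_eq_zero {κ μ : Type*} [Fintype κ] [Fintype μ]
    {E : Matrix κ μ ℍ[ℝ]} (h : Eᴴ * E = 0) : E = 0 := by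
  ext1 k j
  have h1 := congrFun (congrFun h j) j
  rw [Matrix.mul_apply] at h1
  simp only [Matrix.conjTranspose_apply, Quaternion.star_mul_self, Matrix.zero_apply] at h1
  rw [← quaternion_coe_sum, ← Quaternion.coe_zero, Quaternion.coe_inj,
    Finset.sum_eq_zero_iff_of_nonneg fun _ _ => Quaternion.normSq_nonneg] at h1
  exact Quaternion.normSq_eq_zero.1 (h1 k (Finset.mem_univ k))

/-- For s > r the recursion gives M C_s = −C_{s+1}. Descending from orders beyond n, M C_{s+1} = 0
implies M² C_s = 0, hence M C_s = 0 because M is Hermitian. The recursion at s = r, multiplied by M,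
then loses its second term. -/
theorem PosSemidefShift.mul_mul_cofactorMatrix {M : Matrix ι ι ℍ[ℝ]} (hM : PosSemidefShift M)
    {r : ℕ} (hr : r ≤ Fintype.card ι) (h0 : ∀ s, r < s → minorSum s M = 0) {e : ℝ}
    (he : minorSum r M = e) : M * (M * cofactorMatrix r M) = e • M := by
  have hz : ∀ k s, s + k = Fintype.card ι + 1 → r < s → M * cofactorMatrix s M = 0 := by
    intro k
    induction k with
    | zero =>
      intro s hs _
      rw [cofactorMatrix_of_card_lt M (by omega), mul_zero]
    | succ k ih =>
      intro s hs hrs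
      have h1 := hM.mul_cofactorMatrix_add (s := s) (by omega) (e := 0)
        (by rw [h0 s hrs, Quaternion.coe_zero])
      have h2 := congrArg (M * ·) h1
      simp only [mul_add, ih (s + 1) (by omega) (by omega), add_zero, zero_smul, mul_zero] at h2
      refine eq_zero_of_conjTranspose_mul_self_eq_zero ?_
      rw [Matrix.conjTranspose_mul, hM.herm, mul_assoc, h2, mul_zero]
  have h := congrArg (M * ·) (hM.mul_cofactorMatrix_add hr he)
  simp only [mul_add, hz (Fintype.card ι - r) (r + 1) (by omega) (by omega), add_zero,
    Matrix.mul_smul, mul_one] at h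
  exact h

end PositiveSemidefinite

/-! ### Positivity of Gram matrices. -/

section Gram

variable {κ ι : Type*} [Fintype κ] [Fintype ι] [LinearOrder ι]

theorem gram_quadratic (A : Matrix κ ι ℍ[ℝ]) (α : Finset ι) (y : ι → ℍ[ℝ]) :
    ∑ a ∈ α, star (y a) * ∑ b ∈ α, (Aᴴ * A) a b * y b =
      ((∑ k, Quaternion.normSq (∑ b ∈ α, A k b * y b) : ℝ) : ℍ[ℝ]) := by
  rw [quaternion_coe_sum]
  simp only [← Quaternion.star_mul_self, star_sum, star_mul, Finset.sum_mul]
  rw [Finset.sum_comm]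
  refine Finset.sum_congr rfl fun a _ => ?_
  simp only [Matrix.mul_apply, Matrix.conjTranspose_apply, Finset.sum_mul, Finset.mul_sum]
  rw [Finset.sum_comm]
  simp only [mul_assoc]

theorem posDefOn_gram {A : Matrix κ ι ℍ[ℝ]} {α : Finset ι}
    (h : ∀ y : ι → ℍ[ℝ], (∀ k, ∑ c ∈ α, A k c * y c = 0) → ∀ c ∈ α, y c = 0) :
    PosDefOn (Aᴴ * A) α := by
  rintro y ⟨a, ha, hy⟩
  rw [gram_quadratic, Quaternion.re_coe]
  refine lt_of_le_of_ne (Finset.sum_nonneg fun _ _ => Quaternion.normSq_nonneg) fun h0 => ?_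
  rw [eq_comm, Finset.sum_eq_zero_iff_of_nonneg fun _ _ => Quaternion.normSq_nonneg] at h0
  exact hy (h y (fun k => Quaternion.normSq_eq_zero.1 (h0 k (Finset.mem_univ k))) a ha)

theorem posSemidefShift_gram (A : Matrix κ ι ℍ[ℝ]) : PosSemidefShift (Aᴴ * A) where
  herm := Matrix.isHermitian_conjTranspose_mul_self A
  posDef t ht := by
    rintro y ⟨a, ha, hy⟩
    have h : ∀ a, ∑ b, shift (Aᴴ * A) t a b * y b = ∑ b, (Aᴴ * A) a b * y b + t • y a := by
      intro a
      simp only [shift_apply, add_mul, Finset.sum_add_distrib]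
      congr 1
      rw [Finset.sum_eq_single a]
      · simp
      · intro c _ hc
        simp [Pi.single_eq_of_ne hc.symm]
      · simp
    simp only [h, mul_add, Finset.sum_add_distrib]
    rw [gram_quadratic, Quaternion.re_add, Quaternion.re_coe]
    have h2 : ∑ a, star (y a) * t • y a = ((∑ a, t * Quaternion.normSq (y a) : ℝ) : ℍ[ℝ]) := by
      rw [quaternion_coe_sum]
      refine Finset.sum_congr rfl fun a _ => ?_
      rw [mul_smul_comm, Quaternion.star_mul_self, Quaternion.coe_mul,
        Quaternion.coe_mul_eq_smul]
    rw [h2, Quaternion.re_coe]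
    refine add_pos_of_nonneg_of_pos (Finset.sum_nonneg fun _ _ => Quaternion.normSq_nonneg)
      (Finset.sum_pos' (fun _ _ => mul_nonneg ht.le Quaternion.normSq_nonneg)
        ⟨a, ha, mul_pos ht (lt_of_le_of_ne Quaternion.normSq_nonneg
          (Ne.symm (Quaternion.normSq_ne_zero.2 hy)))⟩)

end Gram

/-! ### Column rank and the nonvanishing of sums of principal minors. -/

section Rank

variable {m n p : ℕ}

/-- The right linear map `x ↦ A x`. -/
def mulVecRight (A : Matrix (Fin m) (Fin n) ℍ[ℝ]) :
    (Fin n → ℍ[ℝ]) →ₗ[ℍ[ℝ]ᵐᵒᵖ] (Fin m → ℍ[ℝ]) where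
  toFun := A.mulVec
  map_add' := A.mulVec_add
  map_smul' t x := A.mulVec_smul t x

theorem range_mulVecRight (A : Matrix (Fin m) (Fin n) ℍ[ℝ]) :
    LinearMap.range (mulVecRight A) = Submodule.span ℍ[ℝ]ᵐᵒᵖ (Set.range A.col) := by
  apply le_antisymm
  · rintro _ ⟨x, rfl⟩
    have : mulVecRight A x = ∑ c, MulOpposite.op (x c) • A.col c := by
      ext1 k
      rw [Finset.sum_apply]
      rfl
    rw [this]
    exact Submodule.sum_mem _ fun c _ => Submodule.smul_mem _ _ (Submodule.subset_span ⟨c, rfl⟩)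
  · rw [Submodule.span_le]
    rintro _ ⟨c, rfl⟩
    exact ⟨Pi.single c 1, A.mulVec_single_one c⟩

theorem quatRank_eq_finrank_range (A : Matrix (Fin m) (Fin n) ℍ[ℝ]) :
    quatRank A = Module.finrank ℍ[ℝ]ᵐᵒᵖ (LinearMap.range (mulVecRight A)) := by
  rw [range_mulVecRight, quatRank]

instance : Module.Finite ℍ[ℝ]ᵐᵒᵖ ℍ[ℝ] :=
  ⟨⟨{1}, by
    rw [Finset.coe_singleton, Submodule.eq_top_iff']
    exact fun x => Submodule.mem_span_singleton.2 ⟨MulOpposite.op x, by simp⟩⟩⟩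

theorem quatRank_mul_le (A : Matrix (Fin m) (Fin n) ℍ[ℝ]) (B : Matrix (Fin n) (Fin p) ℍ[ℝ]) :
    quatRank (A * B) ≤ quatRank A := by
  rw [quatRank_eq_finrank_range, quatRank_eq_finrank_range]
  apply Submodule.finrank_mono
  rintro _ ⟨x, rfl⟩
  exact ⟨B.mulVec x, Matrix.mulVec_mulVec x A B⟩

theorem mulVec_eq_zero_of_gram (A : Matrix (Fin m) (Fin n) ℍ[ℝ]) {x : Fin n → ℍ[ℝ]}
    (h : (Aᴴ * A).mulVec x = 0) : A.mulVec x = 0 := by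
  have h1 := gram_quadratic A Finset.univ x
  rw [Finset.sum_eq_zero fun a _ => by
    rw [show ∑ b, (Aᴴ * A) a b * x b = 0 from congrFun h a, mul_zero], ← Quaternion.coe_zero,
    Quaternion.coe_inj, eq_comm,
    Finset.sum_eq_zero_iff_of_nonneg fun _ _ => Quaternion.normSq_nonneg] at h1
  ext1 k
  exact Quaternion.normSq_eq_zero.1 (h1 k (Finset.mem_univ k))

theorem quatRank_gram (A : Matrix (Fin m) (Fin n) ℍ[ℝ]) : quatRank (Aᴴ * A) = quatRank A := by
  have hker : LinearMap.ker (mulVecRight (Aᴴ * A)) = LinearMap.ker (mulVecRight A) := by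
    ext x
    refine ⟨fun h => mulVec_eq_zero_of_gram A h, fun h => ?_⟩
    have h' : A.mulVec x = 0 := h
    change (Aᴴ * A).mulVec x = 0
    rw [← Matrix.mulVec_mulVec, h', Matrix.mulVec_zero]
  have h1 := LinearMap.finrank_range_add_finrank_ker (mulVecRight (Aᴴ * A))
  have h2 := LinearMap.finrank_range_add_finrank_ker (mulVecRight A)
  rw [hker] at h1
  rw [quatRank_eq_finrank_range, quatRank_eq_finrank_range]
  omega

/-- Since rank A = rank A*A ≤ rank A*, applying this to A* as well gives equality. -/
theorem quatRank_conjTranspose (A : Matrix (Fin m) (Fin n) ℍ[ℝ]) : quatRank Aᴴ = quatRank A := by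
  have h : ∀ {m n : ℕ} (A : Matrix (Fin m) (Fin n) ℍ[ℝ]), quatRank A ≤ quatRank Aᴴ :=
    fun A => by
      rw [← quatRank_gram A]
      exact quatRank_mul_le _ _
  refine le_antisymm ?_ (h A)
  simpa using h Aᴴ

theorem quatRank_le_card (A : Matrix (Fin m) (Fin n) ℍ[ℝ]) :
    quatRank A ≤ Fintype.card (Fin n) := by
  rw [quatRank]
  exact finrank_range_le_card _

theorem linearIndependent_col_iff (A : Matrix (Fin m) (Fin n) ℍ[ℝ]) (γ : Finset (Fin n)) :
    LinearIndependent ℍ[ℝ]ᵐᵒᵖ (fun c : γ => A.col c) ↔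
      ∀ y : Fin n → ℍ[ℝ], (∀ k, ∑ c ∈ γ, A k c * y c = 0) → ∀ c ∈ γ, y c = 0 := by
  have hsum : ∀ (g : γ → ℍ[ℝ]ᵐᵒᵖ) k, (∑ c : γ, g c • A.col c) k =
      ∑ c : γ, A k c * (g c).unop := by
    intro g k
    rw [Finset.sum_apply]
    rfl
  rw [Fintype.linearIndependent_iff]
  constructor
  · intro h y hy c hc
    have := h (fun c => MulOpposite.op (y c)) (by
      ext1 k
      rw [hsum]
      exact (Finset.sum_coe_sort γ fun c => A k c * y c).trans (hy k)) ⟨c, hc⟩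
    exact MulOpposite.op_injective this
  · intro h g hg c
    have h1 := h (fun c => if hc : c ∈ γ then (g ⟨c, hc⟩).unop else 0) (fun k => by
      have h2 := congrFun hg k
      rw [hsum] at h2
      rw [← Finset.sum_coe_sort γ]
      refine Eq.trans (Finset.sum_congr rfl fun c _ => ?_) h2
      rw [dif_pos c.2]) c c.2
    rw [dif_pos c.2] at h1
    exact MulOpposite.unop_injective h1

/-- A maximal independent family of columns has a positive definite Gram matrix, whose determinant
is positive. -/
theorem exists_principalMinor_gram_ne_zero (A : Matrix (Fin m) (Fin n) ℍ[ℝ]) :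
    ∃ γ : Finset (Fin n), γ.card = quatRank A ∧ principalMinor (Aᴴ * A) γ ≠ 0 := by
  obtain ⟨κ, a, ha, hspan, hli⟩ := exists_linearIndependent' ℍ[ℝ]ᵐᵒᵖ A.col
  have : Finite κ := Finite.of_injective a ha
  have : Fintype κ := Fintype.ofFinite κ
  refine ⟨Finset.univ.map ⟨a, ha⟩, ?_, ?_⟩
  · rw [Finset.card_map, quatRank, ← hspan, finrank_span_eq_card hli, Finset.card_univ]
  · have h : LinearIndependent ℍ[ℝ]ᵐᵒᵖ
        (fun c : (Finset.univ.map ⟨a, ha⟩ : Finset (Fin n)) => A.col c) := by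
      have hb : ∀ c : (Finset.univ.map ⟨a, ha⟩ : Finset (Fin n)), ∃ k, a k = c := fun c => by
        obtain ⟨k, -, hk⟩ := Finset.mem_map.1 c.2
        exact ⟨k, hk⟩
      choose b hb using hb
      have h1 := LinearIndependent.comp hli b fun c d hcd => Subtype.ext (by
        rw [← hb c, ← hb d, hcd])
      have h2 : (A.col ∘ a) ∘ b = fun c => A.col c.1 := funext fun c => congrArg A.col (hb c)
      rwa [h2] at h1
    obtain ⟨d, d0, H⟩ := (posDefOn_gram ((linearIndependent_col_iff A _).1 h)).exists_cramerOn
      (Matrix.isHermitian_conjTranspose_mul_self A)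
    rw [H.minor_eq]
    exact fun h => d0.ne' (Quaternion.coe_injective h)

/-- More than rank A columns are dependent, and a dependence relation is a null vector of the
corresponding principal submatrix of A*A. -/
theorem minorSum_gram_eq_zero (A : Matrix (Fin m) (Fin n) ℍ[ℝ]) {s : ℕ} (hs : quatRank A < s) :
    minorSum s (Aᴴ * A) = 0 := by
  rw [minorSum_eq_sum]
  refine Finset.sum_eq_zero fun γ hγ => ?_
  have h : ¬ LinearIndependent ℍ[ℝ]ᵐᵒᵖ (fun c : γ => A.col c) := by
    intro h
    have h1 := finrank_span_eq_card h
    rw [Fintype.card_coe, (Finset.mem_powersetCard.1 hγ).2] at h1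
    have h2 : Module.finrank ℍ[ℝ]ᵐᵒᵖ
        (Submodule.span ℍ[ℝ]ᵐᵒᵖ (Set.range fun c : γ => A.col c)) ≤ quatRank A := by
      rw [quatRank]
      apply Submodule.finrank_mono
      apply Submodule.span_mono
      rintro _ ⟨c, rfl⟩
      exact ⟨c, rfl⟩
    omega
  rw [linearIndependent_col_iff] at h
  push Not at h
  obtain ⟨y, hy, c, hc, hne⟩ := h
  refine (posSemidefShift_gram A).principalMinor_eq_zero (w := y) (fun k _ => ?_) hc hne
  simp only [Matrix.mul_apply, Finset.sum_mul, Pi.zero_apply]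
  rw [Finset.sum_comm]
  refine Finset.sum_eq_zero fun l _ => ?_
  simp only [mul_assoc]
  rw [← Finset.mul_sum, hy, mul_zero]

end Rank

/-! ### The Moore–Penrose inverse from the cofactor matrix. -/

section MoorePenrose

variable {m n : ℕ}

/-- The sums of principal minors and the matrices of cofactors of `A* A`, of the order `rank A`. -/
theorem exists_cofactor_data (A : Matrix (Fin m) (Fin n) ℍ[ℝ]) : ∃ e : ℝ, e ≠ 0 ∧
    minorSum (quatRank A) (Aᴴ * A) = e ∧
    IsMoorePenrose A (e⁻¹ • cofactorMatrix (quatRank A) (Aᴴ * A) * Aᴴ) := by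
  have hM := posSemidefShift_gram A
  obtain ⟨e, he, he0⟩ := hM.exists_minorSum_eq (quatRank A)
  have e0 := he0 (exists_principalMinor_gram_ne_zero A)
  refine ⟨e, e0, he, ?_⟩
  have h1 := hM.mul_mul_cofactorMatrix (quatRank_le_card A)
    (fun s hs => minorSum_gram_eq_zero A hs) he
  obtain ⟨hC, hcomm⟩ := hM.cofactorMatrix_herm_comm (quatRank A)
  set K := e⁻¹ • cofactorMatrix (quatRank A) (Aᴴ * A) with hK
  have hKh : Kᴴ = K := by
    rw [hK]
    ext1 a b
    rw [Matrix.conjTranspose_apply, Matrix.smul_apply, Quaternion.star_smul, hC.apply,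
      Matrix.smul_apply]
  have hKc : Aᴴ * A * K = K * (Aᴴ * A) := hcomm.smul_right _
  have hKM : Aᴴ * A * (Aᴴ * A * K) = Aᴴ * A := by
    rw [hK, Matrix.mul_smul, Matrix.mul_smul, h1, smul_smul, inv_mul_cancel₀ e0, one_smul]
  -- With X = AKA*A − A, the relation (A*A)²K = A*A gives A*X = 0. Since X* ends in A*, this forces
  -- X*X = 0.
  have hA : A * (K * (Aᴴ * A)) = A := by
    rw [← sub_eq_zero]
    apply eq_zero_of_conjTranspose_mul_self_eq_zero
    have h2 : (A * (K * (Aᴴ * A)) - A)ᴴ = (Aᴴ * A * K - 1) * Aᴴ := by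
      rw [Matrix.conjTranspose_sub, Matrix.conjTranspose_mul, Matrix.conjTranspose_mul, hKh,
        (Matrix.isHermitian_conjTranspose_mul_self A), Matrix.sub_mul, Matrix.one_mul]
    have h3 : Aᴴ * (A * (K * (Aᴴ * A)) - A) = 0 := by
      rw [Matrix.mul_sub, ← Matrix.mul_assoc, ← hKc, hKM, sub_self]
    rw [h2, Matrix.mul_assoc, h3, Matrix.mul_zero]
  refine ⟨?_, ?_, ?_, ?_⟩
  · simp only [Matrix.conjTranspose_mul, Matrix.conjTranspose_conjTranspose, hKh,
      Matrix.mul_assoc]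
  · rw [Matrix.mul_assoc, Matrix.conjTranspose_mul, hKh,
      (Matrix.isHermitian_conjTranspose_mul_self A), hKc]
  · rw [Matrix.mul_assoc, Matrix.mul_assoc, hA]
  · have h4 : K * (Aᴴ * A) * Aᴴ = Aᴴ := by
      have := congrArg Matrix.conjTranspose hA
      rwa [Matrix.conjTranspose_mul, Matrix.conjTranspose_mul, hKh,
        (Matrix.isHermitian_conjTranspose_mul_self A), hKc] at this
    calc K * Aᴴ * A * (K * Aᴴ) = K * (Aᴴ * A * K) * Aᴴ := by simp only [Matrix.mul_assoc]
      _ = K * (K * (Aᴴ * A) * Aᴴ) := by rw [hKc]; simp only [Matrix.mul_assoc]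
      _ = K * Aᴴ := by rw [h4]

theorem IsMoorePenrose.conjTranspose {A : Matrix (Fin m) (Fin n) ℍ[ℝ]}
    {P : Matrix (Fin n) (Fin m) ℍ[ℝ]} (h : IsMoorePenrose A P) : IsMoorePenrose Aᴴ Pᴴ where
  left_herm := by rw [← Matrix.conjTranspose_mul, h.right_herm, h.right_herm]
  right_herm := by rw [← Matrix.conjTranspose_mul, h.left_herm, h.left_herm]
  inner_inv := by
    rw [Matrix.mul_assoc, ← Matrix.conjTranspose_mul, ← Matrix.conjTranspose_mul, h.inner_inv]
  outer_inv := by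
    rw [Matrix.mul_assoc, ← Matrix.conjTranspose_mul, ← Matrix.conjTranspose_mul, h.outer_inv]

end MoorePenrose

/-! ### The numerators as entries of a product with two cofactor matrices. -/

section CofactorFormulas

variable {ι : Type*} [Fintype ι] [LinearOrder ι]

/-- Conjugating the row version gives the conjugate transpose of the cofactor matrix; being
Hermitian, the same matrix serves both rows and columns. -/
theorem PosSemidefShift.cdetSum_updateCol {M : Matrix ι ι ℍ[ℝ]} (hM : PosSemidefShift M) (s : ℕ)
    (i : ι) (v : ι → ℍ[ℝ]) :
    cdetSum s i (M.updateCol i v) = ∑ k, cofactorMatrix s M i k * v k := by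
  rw [cdetSum_eq_star_rdetSum, ← Matrix.updateRow_conjTranspose, hM.herm,
    rdetSum_updateRow_eq_vecMul, star_sum]
  refine Finset.sum_congr rfl fun k _ => ?_
  rw [star_mul, Pi.star_apply, star_star, (hM.cofactorMatrix_herm_comm s).1.apply]

variable {m n p q : ℕ}

theorem dB_eq (r : ℕ) (A : Matrix (Fin m) (Fin n) ℍ[ℝ]) (B : Matrix (Fin p) (Fin q) ℍ[ℝ])
    (D : Matrix (Fin m) (Fin q) ℍ[ℝ]) (j : Fin p) (k : Fin n) :
    dB r A B D j k = (tildeD A B D * cofactorMatrix r (B * Bᴴ)) k j := by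
  rw [dB, rdetSum_updateRow_eq_vecMul, Matrix.mul_apply]
  rfl

theorem dA_eq (r : ℕ) (A : Matrix (Fin m) (Fin n) ℍ[ℝ]) (B : Matrix (Fin p) (Fin q) ℍ[ℝ])
    (D : Matrix (Fin m) (Fin q) ℍ[ℝ]) (i : Fin n) (l : Fin p) :
    dA r A B D i l = (cofactorMatrix r (Aᴴ * A) * tildeD A B D) i l := by
  rw [dA, (posSemidefShift_gram A).cdetSum_updateCol, Matrix.mul_apply]
  rfl

theorem cdetSum_updateCol_dB (r s : ℕ) (A : Matrix (Fin m) (Fin n) ℍ[ℝ])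
    (B : Matrix (Fin p) (Fin q) ℍ[ℝ]) (D : Matrix (Fin m) (Fin q) ℍ[ℝ]) (i : Fin n) (j : Fin p) :
    cdetSum r i ((Aᴴ * A).updateCol i (dB s A B D j)) =
      (cofactorMatrix r (Aᴴ * A) * tildeD A B D * cofactorMatrix s (B * Bᴴ)) i j := by
  rw [(posSemidefShift_gram A).cdetSum_updateCol, Matrix.mul_assoc, Matrix.mul_apply]
  simp only [dB_eq]

theorem rdetSum_updateRow_dA (r s : ℕ) (A : Matrix (Fin m) (Fin n) ℍ[ℝ])
    (B : Matrix (Fin p) (Fin q) ℍ[ℝ]) (D : Matrix (Fin m) (Fin q) ℍ[ℝ]) (i : Fin n) (j : Fin p) :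
    rdetSum s j ((B * Bᴴ).updateRow j (dA r A B D i)) =
      (cofactorMatrix r (Aᴴ * A) * tildeD A B D * cofactorMatrix s (B * Bᴴ)) i j := by
  rw [rdetSum_updateRow_eq_vecMul, Matrix.mul_apply]
  simp only [dA_eq]

theorem rdetSum_full (j : Fin n) (A : Matrix (Fin n) (Fin n) ℍ[ℝ]) : rdetSum n j A = rdet j A := by
  have h := rdetSum_card j A
  rwa [Fintype.card_fin] at h

theorem cdetSum_full (i : Fin n) (A : Matrix (Fin n) (Fin n) ℍ[ℝ]) : cdetSum n i A = cdet i A := by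
  have h := cdetSum_card i A
  rwa [Fintype.card_fin] at h

theorem minorSum_full (A : Matrix (Fin n) (Fin n) ℍ[ℝ]) : minorSum n A = hermDet A := by
  have h := minorSum_card A
  rwa [Fintype.card_fin] at h

theorem dB_full (A : Matrix (Fin m) (Fin n) ℍ[ℝ]) (B : Matrix (Fin p) (Fin q) ℍ[ℝ])
    (D : Matrix (Fin m) (Fin q) ℍ[ℝ]) (j : Fin p) : dB p A B D j = dBfull A B D j :=
  funext fun _ => rdetSum_full _ _

theorem dA_full (A : Matrix (Fin m) (Fin n) ℍ[ℝ]) (B : Matrix (Fin p) (Fin q) ℍ[ℝ])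
    (D : Matrix (Fin m) (Fin q) ℍ[ℝ]) (i : Fin n) : dA n A B D i = dAfull A B D i :=
  funext fun _ => cdetSum_full _ _

/-- The Moore-Penrose solution `A⁺ D B⁺` in terms of the matrices of cofactors. -/
theorem exists_moorePenrose_solution (A : Matrix (Fin m) (Fin n) ℍ[ℝ])
    (B : Matrix (Fin p) (Fin q) ℍ[ℝ]) (D : Matrix (Fin m) (Fin q) ℍ[ℝ]) :
    ∃ (e₁ e₂ : ℝ) (A' : Matrix (Fin n) (Fin m) ℍ[ℝ]) (B' : Matrix (Fin q) (Fin p) ℍ[ℝ]),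
      e₁ ≠ 0 ∧ e₂ ≠ 0 ∧ minorSum (quatRank A) (Aᴴ * A) = e₁ ∧
      minorSum (quatRank B) (B * Bᴴ) = e₂ ∧ IsMoorePenrose A A' ∧ IsMoorePenrose B B' ∧
      cofactorMatrix (quatRank A) (Aᴴ * A) * tildeD A B D *
        cofactorMatrix (quatRank B) (B * Bᴴ) = (e₁ * e₂) • (A' * D * B') := by
  obtain ⟨e₁, h1, he₁, hA⟩ := exists_cofactor_data A
  -- BB* is the Gram matrix of B*, so the data for B come from B* by conjugate transposition.
  obtain ⟨e₂, h2, he₂, hB⟩ := exists_cofactor_data Bᴴ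
  have hC := ((posSemidefShift_gram Bᴴ).cofactorMatrix_herm_comm (quatRank B)).1
  have hB' := hB.conjTranspose
  rw [Matrix.conjTranspose_mul] at hB'
  simp only [Matrix.conjTranspose_conjTranspose, quatRank_conjTranspose] at he₂ hC hB'
  have hC' : (e₂⁻¹ • cofactorMatrix (quatRank B) (B * Bᴴ))ᴴ =
      e₂⁻¹ • cofactorMatrix (quatRank B) (B * Bᴴ) := by
    ext1 a b
    rw [Matrix.conjTranspose_apply, Matrix.smul_apply, Quaternion.star_smul, hC.apply,
      Matrix.smul_apply]
  rw [hC'] at hB'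
  refine ⟨e₁, e₂, _, _, h1, h2, he₁, he₂, hA, hB', ?_⟩
  simp only [tildeD, Matrix.smul_mul, Matrix.mul_smul, smul_smul, Matrix.mul_assoc]
  rw [show e₁ * e₂ * (e₂⁻¹ * e₁⁻¹) = 1 by field_simp, one_smul]

end CofactorFormulas

/-! ### Least squares and minimum norm by orthogonality. -/

section LeastSquaresSolution

attribute [local instance] Matrix.frobeniusNormedAddCommGroup

variable {m n p q : ℕ}

/-- The real inner product `re tr (X* Y)` of quaternion matrices. -/
noncomputable def reInner (X Y : Matrix (Fin m) (Fin n) ℍ[ℝ]) : ℝ := (Xᴴ * Y).trace.re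

theorem reInner_self (X : Matrix (Fin m) (Fin n) ℍ[ℝ]) : reInner X X = ‖X‖ ^ 2 := by
  have h0 : 0 ≤ ∑ i, ∑ j, ‖X i j‖ ^ (2 : ℝ) :=
    Finset.sum_nonneg fun _ _ => Finset.sum_nonneg fun _ _ => by positivity
  rw [Matrix.frobenius_norm_def, ← Real.sqrt_eq_rpow, Real.sq_sqrt h0, reInner, Matrix.trace,
    Finset.sum_comm]
  simp only [Matrix.diag_apply, Matrix.mul_apply, Matrix.conjTranspose_apply,
    Quaternion.star_mul_self, ← quaternion_coe_sum, Quaternion.re_coe]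
  refine Finset.sum_congr rfl fun _ _ => Finset.sum_congr rfl fun _ _ => ?_
  rw [Quaternion.normSq_eq_norm_mul_self, Real.rpow_two, sq]

theorem re_sum {κ : Type*} (s : Finset κ) (f : κ → ℍ[ℝ]) :
    (∑ i ∈ s, f i).re = ∑ i ∈ s, (f i).re :=
  map_sum (⟨⟨fun x => x.re, Quaternion.re_zero⟩, Quaternion.re_add⟩ : ℍ[ℝ] →+ ℝ) f s

/-- Quaternion traces are not cyclic, but their real parts are, because re(xy) = re(yx). -/
theorem re_trace_mul_comm (P : Matrix (Fin m) (Fin n) ℍ[ℝ]) (Q : Matrix (Fin n) (Fin m) ℍ[ℝ]) :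
    (P * Q).trace.re = (Q * P).trace.re := by
  have h : ∀ {m n : ℕ} (P : Matrix (Fin m) (Fin n) ℍ[ℝ]) (Q : Matrix (Fin n) (Fin m) ℍ[ℝ]),
      (P * Q).trace.re = ∑ i, ∑ j, (P i j * Q j i).re := fun P Q => by
    simp only [Matrix.trace, Matrix.diag_apply, Matrix.mul_apply, re_sum]
  rw [h, h, Finset.sum_comm]
  refine Finset.sum_congr rfl fun _ _ => Finset.sum_congr rfl fun _ _ => ?_
  rw [Quaternion.re_mul, Quaternion.re_mul]
  ring

theorem norm_add_sq_of_reInner_eq_zero {X Y : Matrix (Fin m) (Fin n) ℍ[ℝ]}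
    (h : reInner X Y = 0) : ‖X + Y‖ ^ 2 = ‖X‖ ^ 2 + ‖Y‖ ^ 2 := by
  have h' : reInner Y X = 0 := by
    rw [← h, reInner, reInner, ← Quaternion.re_star, ← Matrix.trace_conjTranspose,
      Matrix.conjTranspose_mul, Matrix.conjTranspose_conjTranspose]
  rw [← reInner_self, ← reInner_self, ← reInner_self]
  unfold reInner at h h' ⊢
  rw [Matrix.conjTranspose_add, Matrix.add_mul, Matrix.mul_add, Matrix.mul_add, Matrix.trace_add,
    Matrix.trace_add, Matrix.trace_add, Quaternion.re_add, Quaternion.re_add, Quaternion.re_add,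
    h, h']
  ring

theorem IsMoorePenrose.conjTranspose_mul_mul {A : Matrix (Fin m) (Fin n) ℍ[ℝ]}
    {A' : Matrix (Fin n) (Fin m) ℍ[ℝ]} (h : IsMoorePenrose A A') : Aᴴ * (A * A') = Aᴴ := by
  have := congrArg Matrix.conjTranspose h.inner_inv
  rwa [Matrix.conjTranspose_mul, h.left_herm] at this

theorem IsMoorePenrose.mul_mul_conjTranspose {A : Matrix (Fin m) (Fin n) ℍ[ℝ]}
    {A' : Matrix (Fin n) (Fin m) ℍ[ℝ]} (h : IsMoorePenrose A A') : A' * A * Aᴴ = Aᴴ := by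
  have := congrArg Matrix.conjTranspose h.inner_inv
  rwa [Matrix.mul_assoc, Matrix.conjTranspose_mul, h.right_herm] at this

/-- `A⁺ D B⁺` is the unique least squares solution of `A X B = D` of minimum norm. -/
theorem isMinNormLeastSquares_iff {A : Matrix (Fin m) (Fin n) ℍ[ℝ]}
    {B : Matrix (Fin p) (Fin q) ℍ[ℝ]} {A' : Matrix (Fin n) (Fin m) ℍ[ℝ]}
    {B' : Matrix (Fin q) (Fin p) ℍ[ℝ]} (hA : IsMoorePenrose A A') (hB : IsMoorePenrose B B')
    (D : Matrix (Fin m) (Fin q) ℍ[ℝ]) (X : Matrix (Fin n) (Fin p) ℍ[ℝ]) :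
    IsMinNormLeastSquares A B D X ↔ X = A' * D * B' := by
  set X₀ := A' * D * B' with hX₀
  have hnormal : Aᴴ * (A * X₀ * B - D) * Bᴴ = 0 := by
    have e : Aᴴ * (A * X₀ * B) * Bᴴ = Aᴴ * (A * A') * D * (B' * B * Bᴴ) := by
      simp only [hX₀, Matrix.mul_assoc]
    rw [Matrix.mul_sub, Matrix.sub_mul, e, hA.conjTranspose_mul_mul, hB.mul_mul_conjTranspose,
      sub_self]
  have hres : ∀ Z : Matrix (Fin n) (Fin p) ℍ[ℝ], reInner (A * X₀ * B - D) (A * Z * B) = 0 := by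
    intro Z
    rw [reInner, ← Matrix.mul_assoc, re_trace_mul_comm]
    have e : B * ((A * X₀ * B - D)ᴴ * (A * Z)) = (Aᴴ * (A * X₀ * B - D) * Bᴴ)ᴴ * Z := by
      simp only [Matrix.conjTranspose_mul, Matrix.conjTranspose_conjTranspose, Matrix.mul_assoc]
    rw [e, hnormal, Matrix.conjTranspose_zero, Matrix.zero_mul, Matrix.trace_zero,
      Quaternion.re_zero]
  -- X₀ is fixed by the orthogonal projections A⁺A on the left and BB⁺ on the right; this makes it
  -- orthogonal to every Z with AZB = 0.
  have hX₀' : X₀ = A' * A * X₀ * (B * B') := by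
    have e : A' * A * X₀ * (B * B') = A' * A * A' * D * (B' * B * B') := by
      simp only [hX₀, Matrix.mul_assoc]
    rw [e, hA.outer_inv, hB.outer_inv]
  have horth : ∀ Z : Matrix (Fin n) (Fin p) ℍ[ℝ], A * Z * B = 0 → reInner X₀ Z = 0 := by
    intro Z hZ
    have e : X₀ᴴ * Z = B * (B' * X₀ᴴ * A' * (A * Z)) := by
      conv_lhs => rw [hX₀', Matrix.conjTranspose_mul, hB.left_herm, Matrix.conjTranspose_mul,
        hA.right_herm]
      simp only [Matrix.mul_assoc]
    rw [reInner, e, re_trace_mul_comm, Matrix.mul_assoc, hZ, Matrix.mul_zero, Matrix.trace_zero,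
      Quaternion.re_zero]
  have hpyth : ∀ Y : Matrix (Fin n) (Fin p) ℍ[ℝ], ‖A * Y * B - D‖ ^ 2 =
      ‖A * X₀ * B - D‖ ^ 2 + ‖A * (Y - X₀) * B‖ ^ 2 := by
    intro Y
    rw [← norm_add_sq_of_reInner_eq_zero (hres _), Matrix.mul_sub, Matrix.sub_mul]
    congr 2
    abel
  have hLS : IsLeastSquares A B D X₀ := fun Y => by
    rw [← sq_le_sq₀ (norm_nonneg _) (norm_nonneg _), hpyth Y]
    exact le_add_of_nonneg_right (sq_nonneg _)
  -- Two least squares solutions have equal residual norms, so A(Y − X₀)B = 0 and Y − X₀ is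
  -- orthogonal to X₀.
  have hLS' : ∀ Y, IsLeastSquares A B D Y → ‖Y‖ ^ 2 = ‖X₀‖ ^ 2 + ‖Y - X₀‖ ^ 2 := by
    intro Y hY
    have h1 := hY X₀
    rw [← sq_le_sq₀ (norm_nonneg _) (norm_nonneg _), hpyth Y] at h1
    have h2 : ‖A * (Y - X₀) * B‖ = 0 := by
      have := sq_nonneg ‖A * (Y - X₀) * B‖
      exact pow_eq_zero_iff two_ne_zero |>.1 (by linarith)
    rw [← norm_add_sq_of_reInner_eq_zero (horth _ (norm_eq_zero.1 h2)), add_sub_cancel]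
  constructor
  · rintro ⟨h1, h2⟩
    have h3 := h2 X₀ hLS
    rw [← sq_le_sq₀ (norm_nonneg _) (norm_nonneg _), hLS' X h1] at h3
    have h4 : ‖X - X₀‖ = 0 := by
      have := sq_nonneg ‖X - X₀‖
      exact pow_eq_zero_iff two_ne_zero |>.1 (by linarith)
    exact sub_eq_zero.1 (norm_eq_zero.1 h4)
  · rintro rfl
    refine ⟨hLS, fun Y hY => ?_⟩
    rw [← sq_le_sq₀ (norm_nonneg _) (norm_nonneg _), hLS' Y hY]
    exact le_add_of_nonneg_right (sq_nonneg _)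

end LeastSquaresSolution

/-! ### Assembly of the four rank cases. -/

theorem theorem4p6 {m n p q : ℕ} (A : Matrix (Fin m) (Fin n) ℍ[ℝ])
    (B : Matrix (Fin p) (Fin q) ℍ[ℝ]) (D : Matrix (Fin m) (Fin q) ℍ[ℝ]) :
    (∃! X : Matrix (Fin n) (Fin p) ℍ[ℝ], IsMinNormLeastSquares A B D X) ∧
    ∀ X : Matrix (Fin n) (Fin p) ℍ[ℝ], IsMinNormLeastSquares A B D X →
      (∃ (A' : Matrix (Fin n) (Fin m) ℍ[ℝ]) (B' : Matrix (Fin q) (Fin p) ℍ[ℝ]),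
        IsMoorePenrose A A' ∧ IsMoorePenrose B B' ∧ X = A' * D * B') ∧
      -- arbitrary ranks (in particular both `A` and `B` of deficient rank)
      (∀ r₁ r₂ : ℕ, quatRank A = r₁ → quatRank B = r₂ →
        minorSum r₁ (Aᴴ * A) ≠ 0 ∧ minorSum r₂ (B * Bᴴ) ≠ 0 ∧
        ∀ (i : Fin n) (j : Fin p),
          X i j = cdetSum r₁ i ((Aᴴ * A).updateCol i (dB r₂ A B D j)) /
            (minorSum r₁ (Aᴴ * A) * minorSum r₂ (B * Bᴴ)) ∧
          X i j = rdetSum r₂ j ((B * Bᴴ).updateRow j (dA r₁ A B D i)) /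
            (minorSum r₁ (Aᴴ * A) * minorSum r₂ (B * Bᴴ))) ∧
      -- both `A` of full column rank and `B` of full row rank
      (quatRank A = n → quatRank B = p →
        hermDet (Aᴴ * A) ≠ 0 ∧ hermDet (B * Bᴴ) ≠ 0 ∧
        ∀ (i : Fin n) (j : Fin p),
          X i j = cdet i ((Aᴴ * A).updateCol i (dBfull A B D j)) /
            (hermDet (Aᴴ * A) * hermDet (B * Bᴴ)) ∧
          X i j = rdet j ((B * Bᴴ).updateRow j (dAfull A B D i)) /
            (hermDet (Aᴴ * A) * hermDet (B * Bᴴ))) ∧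
      -- only `A` of full rank
      (∀ r₂ : ℕ, quatRank A = n → quatRank B = r₂ → r₂ < p →
        hermDet (Aᴴ * A) ≠ 0 ∧ minorSum r₂ (B * Bᴴ) ≠ 0 ∧
        ∀ (i : Fin n) (j : Fin p),
          X i j = cdet i ((Aᴴ * A).updateCol i (dB r₂ A B D j)) /
            (hermDet (Aᴴ * A) * minorSum r₂ (B * Bᴴ)) ∧
          X i j = rdetSum r₂ j ((B * Bᴴ).updateRow j (dAfull A B D i)) /
            (hermDet (Aᴴ * A) * minorSum r₂ (B * Bᴴ))) ∧
      -- only `B` of full rank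
      (∀ r₁ : ℕ, quatRank A = r₁ → r₁ < n → quatRank B = p →
        minorSum r₁ (Aᴴ * A) ≠ 0 ∧ hermDet (B * Bᴴ) ≠ 0 ∧
        ∀ (i : Fin n) (j : Fin p),
          X i j = rdet j ((B * Bᴴ).updateRow j (dA r₁ A B D i)) /
            (minorSum r₁ (Aᴴ * A) * hermDet (B * Bᴴ)) ∧
          X i j = cdetSum r₁ i ((Aᴴ * A).updateCol i (dBfull A B D j)) /
            (minorSum r₁ (Aᴴ * A) * hermDet (B * Bᴴ))) := by
  obtain ⟨e₁, e₂, A', B', h₁, h₂, he₁, he₂, hA, hB, hX⟩ := exists_moorePenrose_solution A B D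
  have hiff := isMinNormLeastSquares_iff hA hB D
  refine ⟨⟨A' * D * B', (hiff _).2 rfl, fun Y hY => (hiff Y).1 hY⟩, fun X hXmin => ?_⟩
  have hXeq := (hiff X).1 hXmin
  have hS : minorSum (quatRank A) (Aᴴ * A) ≠ 0 := by
    rw [he₁]
    exact fun h => h₁ (Quaternion.coe_injective h)
  have hT : minorSum (quatRank B) (B * Bᴴ) ≠ 0 := by
    rw [he₂]
    exact fun h => h₂ (Quaternion.coe_injective h)
  -- The denominators are real and hence central, so division on the right is division by a scalar.
  have main : ∀ i j, X i j =
      (cofactorMatrix (quatRank A) (Aᴴ * A) * tildeD A B D *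
        cofactorMatrix (quatRank B) (B * Bᴴ)) i j /
        (minorSum (quatRank A) (Aᴴ * A) * minorSum (quatRank B) (B * Bᴴ)) := fun i j => by
    rw [eq_div_iff (mul_ne_zero hS hT), he₁, he₂, ← Quaternion.coe_mul,
      Quaternion.mul_coe_eq_smul, hX, ← hXeq, Matrix.smul_apply]
  have hcol : ∀ i j, X i j =
      cdetSum (quatRank A) i ((Aᴴ * A).updateCol i (dB (quatRank B) A B D j)) /
        (minorSum (quatRank A) (Aᴴ * A) * minorSum (quatRank B) (B * Bᴴ)) := fun i j => by
    rw [cdetSum_updateCol_dB, ← main]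
  have hrow : ∀ i j, X i j =
      rdetSum (quatRank B) j ((B * Bᴴ).updateRow j (dA (quatRank A) A B D i)) /
        (minorSum (quatRank A) (Aᴴ * A) * minorSum (quatRank B) (B * Bᴴ)) := fun i j => by
    rw [rdetSum_updateRow_dA, ← main]
  refine ⟨⟨A', B', hA, hB, hXeq⟩, ?_, ?_, ?_, ?_⟩
  · rintro r₁ r₂ rfl rfl
    exact ⟨hS, hT, fun i j => ⟨hcol i j, hrow i j⟩⟩
  · intro hn hp
    -- At full rank the only index set is the whole one, so each sum of minors collapses to a single
    -- determinant.
    simp only [hn, hp, minorSum_full, cdetSum_full, rdetSum_full, dA_full, dB_full]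
      at hS hT hcol hrow
    exact ⟨hS, hT, fun i j => ⟨hcol i j, hrow i j⟩⟩
  · rintro r₂ hn rfl -
    simp only [hn, minorSum_full, cdetSum_full, dA_full] at hS hcol hrow
    exact ⟨hS, hT, fun i j => ⟨hcol i j, hrow i j⟩⟩
  · rintro r₁ rfl - hp
    simp only [hp, minorSum_full, rdetSum_full, dB_full] at hT hcol hrow
    exact ⟨hS, hT, fun i j => ⟨hrow i j, hcol i j⟩⟩
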